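/- For $\rho>0$ let $\mathcal S_\rho=\{z\in\mathbb C:\ |\mathrm{Im}\,z|\le\rho\}$ be the closed strip and $\partial\mathcal S_\rho$ its boundary, i.e. the two lines $\mathrm{Im}\,z=\pm\rho$. Let $H_m(x)=(-1)^m e^{x^2}\frac{d^m}{dx^m}e^{-x^2}$ be the Hermite polynomials. For $n\ge 0$ let $Q_n^{\mathrm{GH}}(f)=\sum_{k=0}^n w_k f(x_k)$ be the $(n+1)$-point Gauss–Hermite quadrature, whose nodes $x_0<\dots<x_n$ are the zeros of $H_{n+1}$ and whose weights are $w_k=\int_{\mathbb R} e^{-x^2}\ell_k(x)\,dx$, with $\ell_k$ the Lagrange basis polynomials of degree $n$ for these nodes, and let $I(f)=\int_{\mathbb R}e^{-x^2}f(x)\,dx$. Theorem. Let $f$ be analytic in $\mathcal S_\rho$ (that is, in a neighbourhood of each point of the closed strip), and suppose that for some $\sigma\in\mathbb R$ and some constants $C,R$ one has $|f(z)|\le C|z|^\sigma$ for all $z\in\mathcal S_\rho$ with $|z|\ge R$. Then $e^{-x^2}f(x)$ is integrable over $\mathbb R$, the function $|e^{-z^2}f(z)|$ is integrable with respect to arc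 length over $\partial\mathcal S_\rho$, and there are real numbers $\mathcal K_n$ such that $$|I(f)-Q_n^{\mathrm{GH}}(f)|\le \mathcal K_n\,e^{-2\rho\sqrt{2n}}\qquad\text{for every integer } n\ge\max\{\lfloor\sigma\rfloor,0\},$$ and $$\lim_{n\to\infty}\mathcal K_n=\int_{\partial\mathcal S_\rho}|e^{-z^2}f(z)|\,|dz|.$$ -/

import Mathlib

/-- The closed infinite strip `{z : |Im z| ≤ ρ}`. -/
def strip (ρ : ℝ) : Set ℂ := {z | z.im ∈ Set.Icc (-ρ) ρ}

/-- The Hermite weight `ω(x) = exp (-x²)`. -/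
noncomputable def hermiteWeight (x : ℝ) : ℝ := Real.exp (-x ^ 2)

/-- The (physicists') Hermite polynomials, normalised to have leading coefficient `2 ^ n`;
`hermiteH_eval` below is the Rodrigues formula. -/
noncomputable def hermiteH : ℕ → Polynomial ℝ
  | 0 => 1
  | n + 1 => 2 * Polynomial.X * hermiteH n - Polynomial.derivative (hermiteH n)

/-- Rodrigues: `H_n(x) = (-1)^n / ω(x) * dⁿω/dxⁿ (x)`. -/
theorem hermiteH_eval (n : ℕ) (x : ℝ) :
    (hermiteH n).eval x = (-1) ^ n / hermiteWeight x * iteratedDeriv n hermiteWeight x := by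
  have key : ∀ m : ℕ, iteratedDeriv m hermiteWeight
      = fun t => (-1) ^ m * ((hermiteH m).eval t * hermiteWeight t) := by
    intro m
    induction m with
    | zero => funext t; simp [hermiteH]
    | succ k ih =>
      funext t
      rw [iteratedDeriv_succ, ih]
      have h1 : HasDerivAt hermiteWeight (hermiteWeight t * (-(2 * t))) t := by
        have h := ((hasDerivAt_pow 2 t).fun_neg).exp
        have e : hermiteWeight = fun y => Real.exp (-y ^ 2) := rfl
        rw [e]
        simpa using h
      have h2 := (((hermiteH k).hasDerivAt t).mul h1).const_mul ((-1 : ℝ) ^ k)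
      refine h2.deriv.trans ?_
      simp only [hermiteH, Polynomial.eval_sub, Polynomial.eval_mul, Polynomial.eval_X,
        Polynomial.eval_ofNat]
      ring
  have hne : hermiteWeight x ≠ 0 := (Real.exp_pos _).ne'
  have hs : ((-1 : ℝ) ^ n) * (-1) ^ n = 1 := by rw [← mul_pow]; simp
  rw [key n, div_mul_eq_mul_div, eq_div_iff hne]
  linear_combination (-(hermiteH n).eval x * hermiteWeight x) * hs

/-- The nodes of the `(n+1)`-point Gauss–Hermite rule: the zeros of `H_{n+1}`. -/
noncomputable def ghNodes (n : ℕ) : Finset ℝ := (hermiteH (n + 1)).roots.toFinset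

/-- The (interpolatory) weight of the node `a`: the `ω`-integral of the Lagrange basis polynomial
that is `1` at `a` and `0` at the other nodes. -/
noncomputable def ghWeight (n : ℕ) (a : ℝ) : ℝ :=
  ∫ x : ℝ, hermiteWeight x * (Lagrange.basis (ghNodes n) id a).eval x

/-- The `(n+1)`-point Gauss–Hermite quadrature `Q_n(f) = ∑ w_k f(x_k)`. -/
noncomputable def ghQuadrature (n : ℕ) (f : ℂ → ℂ) : ℂ :=
  ∑ a ∈ ghNodes n, (ghWeight n a : ℂ) * f a

/-- The weighted integral `I(f) = ∫ ω(x) f(x) dx` over the real line. -/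
noncomputable def weightedIntegral (f : ℂ → ℂ) : ℂ :=
  ∫ x : ℝ, (hermiteWeight x : ℂ) * f x

/-- The arc length integral `∫ g(z) |dz|` over the boundary of the strip, which consists of the
two lines `Im z = ρ` and `Im z = -ρ`. -/
noncomputable def stripBoundaryIntegral (ρ : ℝ) (g : ℂ → ℝ) : ℝ :=
  (∫ x : ℝ, g (x + ρ * Complex.I)) + ∫ x : ℝ, g (x - ρ * Complex.I)

/-!
For `z` off the real line let `e_n(z)` be the quadrature error on the Cauchy kernel `x ↦ 1 / (z - x)`
(`kernelError`). Cauchy's formula on the strip, applied to `f` divided by a polynomial of degree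
`2n + 2` so that the integrals converge, together with Gauss's exactness in degree `2n + 1`, shows
that the error for `f` is `(2πi)⁻¹ ∮ f e_n` over the boundary of the strip
(`ghError_eq_contour_integral`). Hence `𝒦_n = (2π)⁻¹ e^{2ρ√(2n)} ∮ |f| |e_n| |dz|` is an admissible
constant, and its limit is found by dominated convergence. Two facts about `e_n` are needed.

*Pointwise limit* (`tendsto_exp_mul_norm_kernelError`). The product `H_{n+1} e_n` is the Hermite
function of the second kind. With `A_N(z) = ∫_0^∞ t^N e^{-t²/4 + itz} dt` (`halfLineMoment`), it is a
multiple of `A_N(z)` in the upper half-plane, while `e^{-z²} H_N(z)` is a multiple of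
`A_N(z) + (-1)^N A_N(-z)`. Laplace's method around the peak `t = √(2N)` gives both moments
(`tendsto_halfLineMoment_div`), so `e^{2ρ√(2n)} |e_n(z)| → 2π |e^{-z²}|` when `|Im z| = ρ`.

*Domination* (`exists_exp_mul_norm_kernelError_le`). Gauss's exactness applied to a test polynomial
`q` of degree at most `n` bounds `|q(z)|² |e_n(z)|` by a multiple of `∫ ω |q|²`. The extremal choice of
`q` gives `|e_n| ≤ 2√π / (|Im z| κ_{n+1})`, where `κ_n = ∑_{j < n} |H_j|² / (2^j j!)`
(`hermiteKernel`). Along a horizontal line `κ_{n+1} + κ_n` has derivative `4 x κ_n`, so by induction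
`κ_{n+1+k}(x + iρ) ≥ x^{2k} / k! · κ_n(iρ)`, and `κ_n(iρ)` is at least a multiple of `e^{2ρ√(2n)}` by
Laplace's method and Stirling's formula. This bounds `e^{2ρ√(2n)} |e_n|` by any prescribed negative
power of `1 + |x|`, uniformly in `n`.
-/

/-! ### Hermite polynomials and their zeros -/

open Polynomial in
theorem derivative_hermiteH_succ (n : ℕ) :
    derivative (hermiteH (n + 1)) = C (2 * ((n : ℝ) + 1)) * hermiteH n := by
  induction n with
  | zero => simp [hermiteH]; rfl
  | succ n ih =>
    rw [hermiteH, derivative_sub, ih]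
    simp only [derivative_mul, derivative_C, derivative_X, derivative_ofNat]
    have h : hermiteH (n + 1) = 2 * X * hermiteH n - derivative (hermiteH n) := rfl
    have e : (C (2 * (((n + 1 : ℕ) : ℝ) + 1)) : ℝ[X]) = 2 + C (2 * ((n : ℝ) + 1)) := by
      rw [show (2 : ℝ[X]) = C 2 from rfl, ← C_add]; congr 1; push_cast; ring
    rw [e, ih]
    linear_combination (-(C (2 * ((n : ℝ) + 1)))) * h

open Polynomial in
theorem hermiteH_add_two (n : ℕ) :
    hermiteH (n + 2) = 2 * X * hermiteH (n + 1) - C (2 * ((n : ℝ) + 1)) * hermiteH n := by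
  rw [hermiteH, derivative_hermiteH_succ]

theorem natDegree_hermiteH_le (n : ℕ) : (hermiteH n).natDegree ≤ n := by
  induction n with
  | zero => simp [hermiteH]
  | succ n ih =>
    rw [hermiteH]
    have h := (hermiteH n).natDegree_derivative_le
    have h2 : (2 * Polynomial.X * hermiteH n).natDegree ≤ 1 + n :=
      Polynomial.natDegree_mul_le.trans (add_le_add (by compute_degree) ih)
    exact (Polynomial.natDegree_sub_le _ _).trans (by omega)

theorem coeff_hermiteH_self (n : ℕ) : (hermiteH n).coeff n = 2 ^ n := by
  induction n with
  | zero => simp [hermiteH]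
  | succ n ih =>
    rw [hermiteH, Polynomial.coeff_sub, mul_assoc, Polynomial.coeff_ofNat_mul,
      Polynomial.coeff_X_mul, ih, Polynomial.coeff_eq_zero_of_natDegree_lt]
    · ring
    · exact lt_of_le_of_lt ((hermiteH n).natDegree_derivative_le) (by
        have := natDegree_hermiteH_le n; omega)

theorem natDegree_hermiteH (n : ℕ) : (hermiteH n).natDegree = n :=
  le_antisymm (natDegree_hermiteH_le n) (Polynomial.le_natDegree_of_ne_zero (by
    rw [coeff_hermiteH_self]; positivity))

/-- The Hermite polynomial `H_n` as a function on the complex plane. -/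
noncomputable def hermiteC (n : ℕ) (z : ℂ) : ℂ := Polynomial.aeval z (hermiteH n)

theorem hermiteC_ofReal (n : ℕ) (x : ℝ) : hermiteC n x = ((hermiteH n).eval x : ℝ) := by
  rw [hermiteC]
  exact Polynomial.aeval_algebraMap_apply_eq_algebraMap_eval x (hermiteH n)

theorem eval_map_hermiteH (n : ℕ) (z : ℂ) :
    ((hermiteH n).map (algebraMap ℝ ℂ)).eval z = hermiteC n z := by
  rw [hermiteC, Polynomial.eval_map_algebraMap]

@[simp] theorem hermiteC_zero (z : ℂ) : hermiteC 0 z = 1 := by simp [hermiteC, hermiteH]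

theorem hermiteC_one (z : ℂ) : hermiteC 1 z = 2 * z := by
  simp [hermiteC, hermiteH, map_ofNat (Polynomial.aeval z)]

theorem hermiteC_add_two (n : ℕ) (z : ℂ) :
    hermiteC (n + 2) z = 2 * z * hermiteC (n + 1) z - 2 * ((n : ℂ) + 1) * hermiteC n z := by
  simp [hermiteC, hermiteH_add_two, map_ofNat (Polynomial.aeval z)]

theorem hasDerivAt_hermiteC_succ (n : ℕ) (z : ℂ) :
    HasDerivAt (hermiteC (n + 1)) (2 * ((n : ℂ) + 1) * hermiteC n z) z := by
  have h := (hermiteH (n + 1)).hasDerivAt_aeval z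
  rw [derivative_hermiteH_succ] at h
  have e : (algebraMap ℝ ℂ) (2 * ((n : ℝ) + 1)) = 2 * ((n : ℂ) + 1) := by simp
  rw [map_mul, Polynomial.aeval_C, e] at h
  exact h

theorem continuous_hermiteC (n : ℕ) : Continuous (hermiteC n) :=
  (hermiteH n).continuous_aeval

open ComplexConjugate in
theorem hermiteC_conj (n : ℕ) (z : ℂ) : hermiteC n (conj z) = conj (hermiteC n z) :=
  Polynomial.aeval_conj _ _

theorem hermiteC_neg (n : ℕ) (z : ℂ) : hermiteC n (-z) = (-1) ^ n * hermiteC n z := by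
  induction n using Nat.twoStepInduction with
  | zero => simp
  | one => simp [hermiteC_one]
  | more n ih1 ih2 => rw [hermiteC_add_two, hermiteC_add_two, ih1, ih2]; ring

open ComplexConjugate in
/-- `Im (H_{n+1}(z) conj H_n(z))` is a positive multiple of `Im z` times the Christoffel-Darboux sum.
Its positivity keeps the zeros of the Hermite polynomials on the real line. -/
theorem im_hermiteC_succ_mul_conj_pos {z : ℂ} (hz : 0 < z.im) (n : ℕ) :
    0 < (hermiteC (n + 1) z * conj (hermiteC n z)).im := by
  induction n with
  | zero => simpa [hermiteC_one] using hz
  | succ n ih =>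
    have h : (hermiteC (n + 1 + 1) z * conj (hermiteC (n + 1) z)).im =
        2 * z.im * Complex.normSq (hermiteC (n + 1) z)
          + 2 * ((n : ℝ) + 1) * (hermiteC (n + 1) z * conj (hermiteC n z)).im := by
      rw [hermiteC_add_two]
      simp [Complex.normSq_apply]
      ring
    rw [h]
    have := Complex.normSq_nonneg (hermiteC (n + 1) z)
    positivity

theorem hermiteC_ne_zero_of_im_pos {z : ℂ} (hz : 0 < z.im) (n : ℕ) : hermiteC n z ≠ 0 := by
  intro h
  have := im_hermiteC_succ_mul_conj_pos hz n
  simp [h] at this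

theorem hermiteC_ne_zero_of_im_ne_zero {z : ℂ} (hz : z.im ≠ 0) (n : ℕ) : hermiteC n z ≠ 0 := by
  rcases lt_or_gt_of_ne hz with h | h
  · intro h0
    have h1 := hermiteC_conj n z
    rw [h0, map_zero] at h1
    exact hermiteC_ne_zero_of_im_pos (by simpa using h) n h1
  · exact hermiteC_ne_zero_of_im_pos h n

open Polynomial in
theorem splits_hermiteH (n : ℕ) : (hermiteH n).Splits := by
  refine Splits.of_splits_map_of_injective (i := algebraMap ℝ ℂ) (algebraMap ℝ ℂ).injective
    (IsAlgClosed.splits _) ?_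
  intro z hz
  have h0 := (mem_roots'.1 hz).2
  rw [IsRoot, eval_map_hermiteH] at h0
  have him : z.im = 0 := by
    by_contra h
    exact hermiteC_ne_zero_of_im_ne_zero h n h0
  exact ⟨z.re, Complex.ext (by simp) (by simp [him])⟩

open Polynomial in
theorem isCoprime_hermiteH_succ (n : ℕ) : IsCoprime (hermiteH (n + 1)) (hermiteH n) := by
  induction n with
  | zero => exact isCoprime_one_right
  | succ n ih =>
    rw [hermiteH_add_two]
    have hu : IsUnit (C (2 * ((n : ℝ) + 1))) := isUnit_C.2 (IsUnit.mk0 _ (by positivity))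
    have h2 : IsCoprime (-(C (2 * ((n : ℝ) + 1)) * hermiteH n)) (hermiteH (n + 1)) :=
      ((isCoprime_mul_unit_left_left hu _ _).2 ih.symm).neg_left
    have h3 := h2.add_mul_right_left (2 * X)
    have e : 2 * X * hermiteH (n + 1) - C (2 * ((n : ℝ) + 1)) * hermiteH n
        = -(C (2 * ((n : ℝ) + 1)) * hermiteH n) + 2 * X * hermiteH (n + 1) := by ring
    rw [e]
    exact h3

open Polynomial in
theorem separable_hermiteH (n : ℕ) : (hermiteH n).Separable := by
  cases n with
  | zero => exact separable_one
  | succ n =>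
    rw [Separable, derivative_hermiteH_succ]
    exact (isCoprime_mul_unit_left_right (isUnit_C.2 (IsUnit.mk0 _ (by positivity))) _ _).2
      (isCoprime_hermiteH_succ n)

/-- The rule has `n + 1` nodes: the zeros of `H_{n+1}` are real and simple. -/
theorem card_ghNodes (n : ℕ) : (ghNodes n).card = n + 1 := by
  rw [ghNodes, Multiset.toFinset_card_of_nodup
    (Polynomial.nodup_roots (separable_hermiteH (n + 1))),
    ← (splits_hermiteH (n + 1)).natDegree_eq_card_roots, natDegree_hermiteH]

theorem eval_hermiteH_of_mem_ghNodes {n : ℕ} {a : ℝ} (ha : a ∈ ghNodes n) :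
    (hermiteH (n + 1)).eval a = 0 :=
  Polynomial.isRoot_of_mem_roots (Multiset.mem_toFinset.1 ha)

/-! ### Gaussian quadrature -/

theorem hermiteWeight_pos (x : ℝ) : 0 < hermiteWeight x := Real.exp_pos _

theorem continuous_hermiteWeight : Continuous hermiteWeight := by
  unfold hermiteWeight; fun_prop

theorem integrable_hermiteWeight_mul_one_add_abs_pow (m : ℕ) :
    MeasureTheory.Integrable (fun x : ℝ => hermiteWeight x * (1 + |x|) ^ m) := by
  have h := (integrable_exp_neg_mul_sq (b := 1 / 2) (by norm_num)).const_mul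
    ((m.factorial : ℝ) * Real.exp (3 / 2))
  refine h.mono' (by
    have := continuous_hermiteWeight
    exact Continuous.aestronglyMeasurable (by fun_prop)) (Filter.Eventually.of_forall fun x => ?_)
  have hf : (0 : ℝ) < m.factorial := by exact_mod_cast m.factorial_pos
  have h1 : (1 + |x|) ^ m ≤ m.factorial * Real.exp (1 + |x|) := by
    have := Real.pow_div_factorial_le_exp (1 + |x|) (by positivity) m
    rwa [div_le_iff₀' hf] at this
  rw [Real.norm_of_nonneg (mul_nonneg (hermiteWeight_pos x).le (by positivity))]
  calc hermiteWeight x * (1 + |x|) ^ m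
      ≤ Real.exp (-x ^ 2) * (m.factorial * Real.exp (1 + |x|)) :=
        mul_le_mul_of_nonneg_left h1 (Real.exp_pos _).le
    _ = m.factorial * Real.exp (-x ^ 2 + (1 + |x|)) := by
        rw [Real.exp_add (-x ^ 2) (1 + |x|)]; ring
    _ ≤ m.factorial * Real.exp (3 / 2 + -(1 / 2) * x ^ 2) := by
        refine mul_le_mul_of_nonneg_left (Real.exp_le_exp.2 ?_) hf.le
        have : |x| ^ 2 = x ^ 2 := sq_abs x
        nlinarith [sq_nonneg (|x| - 1)]
    _ = _ := by rw [Real.exp_add]; ring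

/-- Functions of polynomial growth are integrable against the Hermite weight. -/
theorem integrable_hermiteWeight_mul {g : ℝ → ℂ}
    (hg : MeasureTheory.AEStronglyMeasurable g) {C : ℝ} {m : ℕ}
    (hC : ∀ x, ‖g x‖ ≤ C * (1 + |x|) ^ m) :
    MeasureTheory.Integrable (fun x : ℝ => (hermiteWeight x : ℂ) * g x) := by
  refine ((integrable_hermiteWeight_mul_one_add_abs_pow m).const_mul C).mono'
    (MeasureTheory.AEStronglyMeasurable.mul
      (Complex.continuous_ofReal.comp continuous_hermiteWeight).aestronglyMeasurable hg)
    (Filter.Eventually.of_forall fun x => ?_)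
  rw [norm_mul, Complex.norm_real, Real.norm_of_nonneg (hermiteWeight_pos x).le]
  calc _ ≤ hermiteWeight x * (C * (1 + |x|) ^ m) :=
        mul_le_mul_of_nonneg_left (hC x) (hermiteWeight_pos x).le
    _ = _ := by ring

open Polynomial in
theorem exists_norm_eval_ofReal_le (p : ℂ[X]) :
    ∃ C, ∀ x : ℝ, ‖p.eval (x : ℂ)‖ ≤ C * (1 + |x|) ^ p.natDegree := by
  refine ⟨∑ i ∈ Finset.range (p.natDegree + 1), ‖p.coeff i‖, fun x => ?_⟩
  rw [eval_eq_sum_range, Finset.sum_mul]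
  refine (norm_sum_le _ _).trans (Finset.sum_le_sum fun i hi => ?_)
  rw [norm_mul, norm_pow, Complex.norm_real, Real.norm_eq_abs]
  refine mul_le_mul_of_nonneg_left ?_ (norm_nonneg _)
  calc |x| ^ i ≤ (1 + |x|) ^ i := pow_le_pow_left₀ (abs_nonneg x) (by linarith) i
    _ ≤ _ := pow_le_pow_right₀ (by linarith [abs_nonneg x]) (by
      have := Finset.mem_range.1 hi; omega)

open Polynomial in
theorem continuous_eval_ofReal (p : ℂ[X]) : Continuous fun x : ℝ => p.eval (x : ℂ) :=
  p.continuous.comp Complex.continuous_ofReal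

open Polynomial in
theorem integrable_hermiteWeight_mul_eval_mul (p : ℂ[X]) {g : ℝ → ℂ} (hg : Continuous g) {C : ℝ}
    (hC : ∀ x, ‖g x‖ ≤ C) :
    MeasureTheory.Integrable (fun x : ℝ => (hermiteWeight x : ℂ) * (p.eval (x : ℂ) * g x)) := by
  obtain ⟨K, hK⟩ := exists_norm_eval_ofReal_le p
  refine integrable_hermiteWeight_mul (C := K * C) (m := p.natDegree)
    ((continuous_eval_ofReal p).mul hg).aestronglyMeasurable fun x => ?_
  rw [norm_mul]
  calc _ ≤ (K * (1 + |x|) ^ p.natDegree) * C :=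
        mul_le_mul (hK x) (hC x) (norm_nonneg _) ((norm_nonneg _).trans (hK x))
    _ = _ := by ring

open Polynomial in
theorem integrable_hermiteWeight_mul_eval (p : ℂ[X]) :
    MeasureTheory.Integrable (fun x : ℝ => (hermiteWeight x : ℂ) * p.eval (x : ℂ)) := by
  simpa using integrable_hermiteWeight_mul_eval_mul p (g := fun _ => 1) continuous_const
    (C := 1) (by simp)

/-- The derivative of `ω H_n` is `-ω H_{n+1}`. -/
theorem hasDerivAt_hermiteWeight_mul_hermiteC (n : ℕ) (x : ℝ) :
    HasDerivAt (fun t : ℝ => (hermiteWeight t : ℂ) * hermiteC n t)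
      (-((hermiteWeight x : ℂ) * hermiteC (n + 1) x)) x := by
  have h1 : HasDerivAt hermiteWeight (hermiteWeight x * (-(2 * x))) x := by
    have h := ((hasDerivAt_pow 2 x).fun_neg).exp
    have e : hermiteWeight = fun y => Real.exp (-y ^ 2) := rfl
    rw [e]
    simpa using h
  have h2 := (h1.mul ((hermiteH n).hasDerivAt x)).ofReal_comp
  have e : (fun t : ℝ => (hermiteWeight t : ℂ) * hermiteC n t)
      = fun t : ℝ => (((hermiteWeight * fun y => (hermiteH n).eval y) t : ℝ) : ℂ) := by
    funext t; rw [hermiteC_ofReal]; simp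
  rw [e]
  convert h2 using 1
  rw [hermiteC_ofReal, hermiteH]
  simp
  ring

open Polynomial in
theorem integrable_hermiteWeight_mul_hermiteC_mul (n : ℕ) {g : ℝ → ℂ} (hg : Continuous g) {C : ℝ}
    (hC : ∀ x, ‖g x‖ ≤ C) :
    MeasureTheory.Integrable (fun x : ℝ => (hermiteWeight x : ℂ) * hermiteC n x * g x) := by
  have := integrable_hermiteWeight_mul_eval_mul ((hermiteH n).map (algebraMap ℝ ℂ)) hg hC
  simpa only [eval_map_hermiteH, ← mul_assoc] using this

/-- Integration by parts, by Rodrigues' formula: `∫ ω H_{n+1} g = ∫ ω H_n g'`. -/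
theorem integral_hermiteWeight_mul_hermiteC_succ_mul (n : ℕ) {g g' : ℝ → ℂ}
    (hg : ∀ x, HasDerivAt g (g' x) x)
    (h1 : MeasureTheory.Integrable fun x : ℝ => (hermiteWeight x : ℂ) * hermiteC (n + 1) x * g x)
    (h2 : MeasureTheory.Integrable fun x : ℝ => (hermiteWeight x : ℂ) * hermiteC n x * g' x)
    (h3 : MeasureTheory.Integrable fun x : ℝ => (hermiteWeight x : ℂ) * hermiteC n x * g x) :
    ∫ x : ℝ, (hermiteWeight x : ℂ) * hermiteC (n + 1) x * g x
      = ∫ x : ℝ, (hermiteWeight x : ℂ) * hermiteC n x * g' x := by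
  have h := MeasureTheory.integral_mul_deriv_eq_deriv_mul_of_integrable
    (u := fun x : ℝ => (hermiteWeight x : ℂ) * hermiteC n x) (v := g)
    (u' := fun x : ℝ => -((hermiteWeight x : ℂ) * hermiteC (n + 1) x)) (v' := g')
    (fun x _ => hasDerivAt_hermiteWeight_mul_hermiteC n x) (fun x _ => hg x) h2
    (by convert h1.neg using 1; funext x; simp) h3
  rw [h, ← MeasureTheory.integral_neg]
  congr 1; funext x; ring

open Polynomial in
/-- `H_n` is orthogonal to all polynomials of lower degree. -/
theorem integral_hermiteWeight_mul_hermiteC_mul_eval (n : ℕ) (p : ℂ[X]) (hp : p.natDegree < n) :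
    ∫ x : ℝ, (hermiteWeight x : ℂ) * hermiteC n x * p.eval (x : ℂ) = 0 := by
  induction n generalizing p with
  | zero => omega
  | succ n ih =>
    have hi (k : ℕ) (q : ℂ[X]) : MeasureTheory.Integrable
        fun x : ℝ => (hermiteWeight x : ℂ) * hermiteC k x * q.eval (x : ℂ) := by
      have := integrable_hermiteWeight_mul_eval ((hermiteH k).map (algebraMap ℝ ℂ) * q)
      simpa only [eval_mul, eval_map_hermiteH, ← mul_assoc] using this
    rw [integral_hermiteWeight_mul_hermiteC_succ_mul n
      (fun x => (p.hasDerivAt (x : ℂ)).comp_ofReal) (hi _ _) (hi _ _) (hi _ _)]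
    rcases Nat.eq_zero_or_pos p.natDegree with h0 | h0
    · rw [Polynomial.natDegree_eq_zero.1 h0 |>.choose_spec.symm]; simp
    · exact ih _ (lt_of_lt_of_le (natDegree_derivative_lt h0.ne') (by omega))

/-- The error functional of the `(n+1)`-point Gauss-Hermite rule, for functions on the real line. -/
noncomputable def ghError (n : ℕ) (g : ℝ → ℂ) : ℂ :=
  (∫ x : ℝ, (hermiteWeight x : ℂ) * g x) - ∑ a ∈ ghNodes n, (ghWeight n a : ℂ) * g a

theorem ghError_add {n : ℕ} {g h : ℝ → ℂ}
    (hg : MeasureTheory.Integrable fun x : ℝ => (hermiteWeight x : ℂ) * g x)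
    (hh : MeasureTheory.Integrable fun x : ℝ => (hermiteWeight x : ℂ) * h x) :
    ghError n (fun x => g x + h x) = ghError n g + ghError n h := by
  simp only [ghError, mul_add, Finset.sum_add_distrib]
  rw [MeasureTheory.integral_add hg hh]
  ring

theorem ghError_const_mul (n : ℕ) (c : ℂ) (g : ℝ → ℂ) :
    ghError n (fun x => c * g x) = c * ghError n g := by
  simp only [ghError, mul_sub, Finset.mul_sum, ← MeasureTheory.integral_const_mul]
  congr 1
  · congr 1; funext x; ring
  · refine Finset.sum_congr rfl fun a _ => by ring

open Polynomial in
/-- The rule is interpolatory: it is exact in degree at most `n`. -/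
theorem ghError_eval_of_natDegree_le (n : ℕ) (p : ℂ[X]) (hp : p.natDegree ≤ n) :
    ghError n (fun x => p.eval (x : ℂ)) = 0 := by
  set L : ℝ → ℂ[X] := fun a => (Lagrange.basis (ghNodes n) id a).map (algebraMap ℝ ℂ) with hL
  have hinj : Set.InjOn (id : ℝ → ℝ) (ghNodes n) := Function.injective_id.injOn
  have hLe (a x : ℝ) : (L a).eval (x : ℂ)
      = ((Lagrange.basis (ghNodes n) id a).eval x : ℝ) := by
    rw [hL]; exact eval_map_apply (algebraMap ℝ ℂ) x
  have hpe : p = ∑ a ∈ ghNodes n, C (p.eval (a : ℂ)) * L a := by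
    refine eq_of_degrees_lt_of_eval_index_eq (v := fun a : ℝ => (a : ℂ)) (ghNodes n)
      (fun a _ b _ h => by simpa using h) ?_ ?_ ?_
    · rw [card_ghNodes]
      exact lt_of_le_of_lt degree_le_natDegree (by exact_mod_cast Nat.lt_succ_of_le hp)
    · rw [card_ghNodes]
      refine lt_of_le_of_lt (degree_sum_le _ _) ?_
      rw [Finset.sup_lt_iff (by exact_mod_cast WithBot.bot_lt_coe _)]
      intro a ha
      rw [← smul_eq_C_mul]
      refine lt_of_le_of_lt (degree_smul_le _ _) ?_
      rw [hL, degree_map, Lagrange.degree_basis hinj ha, card_ghNodes]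
      exact_mod_cast Nat.lt_succ_self n
    · intro b hb
      rw [eval_finsetSum, Finset.sum_eq_single b]
      · rw [eval_mul, eval_C, hLe]
        have := Lagrange.eval_basis_self hinj hb
        simp only [id] at this
        rw [this]; simp
      · intro a _ hab
        rw [eval_mul, hLe]
        have := Lagrange.eval_basis_of_ne (v := (id : ℝ → ℝ)) hab hb
        simp only [id] at this
        rw [this]; simp
      · exact fun h => absurd hb h
  have hi (a : ℝ) : MeasureTheory.Integrable
      fun x : ℝ => (hermiteWeight x : ℂ) * (p.eval (a : ℂ) * (L a).eval (x : ℂ)) := by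
    have := integrable_hermiteWeight_mul_eval (C (p.eval (a : ℂ)) * L a)
    simpa using this
  have hint : ∫ x : ℝ, (hermiteWeight x : ℂ) * p.eval (x : ℂ)
      = ∑ a ∈ ghNodes n, (ghWeight n a : ℂ) * p.eval (a : ℂ) := by
    have e (x : ℝ) : (hermiteWeight x : ℂ) * p.eval (x : ℂ)
        = ∑ a ∈ ghNodes n, (hermiteWeight x : ℂ) * (p.eval (a : ℂ) * (L a).eval (x : ℂ)) := by
      conv_lhs => rw [hpe]
      simp [eval_finsetSum, Finset.mul_sum]
    simp_rw [e]
    rw [MeasureTheory.integral_finsetSum _ fun a _ => hi a]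
    refine Finset.sum_congr rfl fun a _ => ?_
    rw [ghWeight, ← integral_complex_ofReal, ← MeasureTheory.integral_mul_const]
    congr 1; funext x
    rw [hLe]; push_cast; ring
  rw [ghError, hint, sub_self]

open Polynomial in
/-- Gauss's theorem: the rule is exact in degree at most `2n + 1`. -/
theorem ghError_eval (n : ℕ) (p : ℂ[X]) (hp : p.natDegree ≤ 2 * n + 1) :
    ghError n (fun x => p.eval (x : ℂ)) = 0 := by
  set H := (hermiteH (n + 1)).map (algebraMap ℝ ℂ) with hH
  have hHd : H.natDegree = n + 1 := by rw [hH, natDegree_map, natDegree_hermiteH]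
  have hH0 : H ≠ 0 := by intro h; rw [h] at hHd; simp at hHd
  have hdiv : p = H * (p / H) + p % H := (EuclideanDomain.div_add_mod p H).symm
  have hr : (p % H).natDegree ≤ n := by
    have := natDegree_mod_lt p (q := H) (by omega)
    omega
  have hq : (p / H).natDegree ≤ n := by
    by_cases hq0 : p / H = 0
    · simp [hq0]
    have h1 : (H * (p / H)).natDegree ≤ 2 * n + 1 := by
      rw [eq_sub_of_add_eq hdiv.symm]
      exact (natDegree_sub_le _ _).trans (by omega)
    rw [natDegree_mul hH0 hq0] at h1
    omega
  have e : (fun x : ℝ => p.eval (x : ℂ))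
      = fun x : ℝ => (H * (p / H)).eval (x : ℂ) + (p % H).eval (x : ℂ) := by
    funext x; rw [← eval_add, ← hdiv]
  rw [e, ghError_add (integrable_hermiteWeight_mul_eval _) (integrable_hermiteWeight_mul_eval _),
    ghError_eval_of_natDegree_le n _ hr, add_zero, ghError]
  have h1 : ∀ x : ℝ, (hermiteWeight x : ℂ) * (H * (p / H)).eval (x : ℂ)
      = (hermiteWeight x : ℂ) * hermiteC (n + 1) x * (p / H).eval (x : ℂ) := fun x => by
    rw [eval_mul, hH, eval_map_hermiteH, mul_assoc]
  simp_rw [h1]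
  rw [integral_hermiteWeight_mul_hermiteC_mul_eval _ _ (by omega), zero_sub, neg_eq_zero]
  refine Finset.sum_eq_zero fun a ha => ?_
  rw [eval_mul, hH, eval_map_hermiteH, hermiteC_ofReal, eval_hermiteH_of_mem_ghNodes ha]
  simp

open Polynomial in
theorem ghWeight_nonneg {n : ℕ} {a : ℝ} (ha : a ∈ ghNodes n) : 0 ≤ ghWeight n a := by
  have hinj : Set.InjOn (id : ℝ → ℝ) (ghNodes n) := Function.injective_id.injOn
  -- exactness on the square of the Lagrange basis polynomial
  set l := Lagrange.basis (ghNodes n) id a with hl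
  have hd : l.natDegree = n := by
    rw [hl, Lagrange.natDegree_basis hinj ha, card_ghNodes]; rfl
  have h := ghError_eval n ((l * l).map (algebraMap ℝ ℂ)) (by
    rw [natDegree_map]; exact natDegree_mul_le.trans (by omega))
  have he (x : ℝ) : ((l * l).map (algebraMap ℝ ℂ)).eval (x : ℂ) = ((l.eval x * l.eval x : ℝ) : ℂ) := by
    rw [← eval_mul]; exact eval_map_apply (algebraMap ℝ ℂ) x
  have h1 : l.eval a = 1 := Lagrange.eval_basis_self hinj ha
  rw [ghError, Finset.sum_eq_single a, sub_eq_zero] at h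
  · have h2 : (∫ x : ℝ, hermiteWeight x * (l.eval x * l.eval x)) = ghWeight n a := by
      apply Complex.ofReal_injective
      rw [← integral_complex_ofReal]
      simp_rw [he] at h
      rw [h1] at h
      simpa using h
    rw [← h2]
    exact MeasureTheory.integral_nonneg fun x =>
      mul_nonneg (hermiteWeight_pos x).le (mul_self_nonneg _)
  · intro b hb hba
    have : l.eval b = 0 := Lagrange.eval_basis_of_ne (v := (id : ℝ → ℝ)) hba.symm hb
    rw [he, this]; simp
  · exact fun h => absurd ha h

/-! ### The Cauchy kernel and the kernel polynomial -/

theorem sub_ofReal_ne_zero {z : ℂ} (hz : z.im ≠ 0) (x : ℝ) : z - x ≠ 0 := fun h => hz (by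
  have := congrArg Complex.im h
  simpa using this)

theorem norm_inv_sub_ofReal_le {z : ℂ} (hz : z.im ≠ 0) (x : ℝ) : ‖(z - x)⁻¹‖ ≤ |z.im|⁻¹ := by
  rw [norm_inv]
  refine inv_anti₀ (abs_pos.2 hz) ?_
  simpa using Complex.abs_im_le_norm (z - x)

theorem continuous_inv_sub_ofReal {z : ℂ} (hz : z.im ≠ 0) :
    Continuous fun x : ℝ => (z - x)⁻¹ :=
  Continuous.inv₀ (by fun_prop) (sub_ofReal_ne_zero hz)

/-- The error of the Gauss-Hermite rule on the Cauchy kernel `x ↦ 1 / (z - x)`. -/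
noncomputable def kernelError (n : ℕ) (z : ℂ) : ℂ := ghError n fun x => (z - x)⁻¹

open Polynomial in
/-- The rule is exact on the divided difference `(p(z) - p(x)) / (z - x)`, so that `p(z)` may be
exchanged for `p(x)` under the error functional. -/
theorem eval_mul_kernelError (n : ℕ) {z : ℂ} (hz : z.im ≠ 0) (p : ℂ[X])
    (hp : p.natDegree ≤ 2 * n + 2) :
    p.eval z * kernelError n z = ghError n fun x => p.eval (x : ℂ) * (z - x)⁻¹ := by
  set q := p /ₘ (X - C z) with hq
  have hqd : q.natDegree ≤ 2 * n + 1 := by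
    rw [hq, natDegree_divByMonic _ (monic_X_sub_C z), natDegree_X_sub_C]; omega
  have hpq (x : ℝ) : p.eval (x : ℂ) = p.eval z + (x - z) * q.eval (x : ℂ) := by
    have h := modByMonic_add_div p (X - C z)
    rw [modByMonic_X_sub_C_eq_C_eval] at h
    have := congrArg (eval (x : ℂ)) h
    simpa using this.symm
  have e : (fun x : ℝ => p.eval (x : ℂ) * (z - x)⁻¹)
      = fun x : ℝ => p.eval z * (z - x)⁻¹ + (-q).eval (x : ℂ) := by
    funext x
    have := sub_ofReal_ne_zero hz x
    rw [hpq x, eval_neg]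
    field_simp
    ring
  rw [e, ghError_add, ghError_const_mul, ghError_eval n (-q) (by rwa [natDegree_neg]), add_zero,
    kernelError]
  · have := integrable_hermiteWeight_mul_eval_mul (C (p.eval z)) (continuous_inv_sub_ofReal hz)
      (norm_inv_sub_ofReal_le hz)
    simpa only [eval_C] using this
  · exact integrable_hermiteWeight_mul_eval (-q)

open Polynomial in
/-- `H_{n+1}` vanishes at the nodes, so only the integral is left of the error functional. -/
theorem hermiteC_mul_kernelError (n : ℕ) {z : ℂ} (hz : z.im ≠ 0) :
    hermiteC (n + 1) z * kernelError n z
      = ∫ x : ℝ, (hermiteWeight x : ℂ) * hermiteC (n + 1) x * (z - x)⁻¹ := by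
  rw [← eval_map_hermiteH, eval_mul_kernelError n hz _ (by
    rw [natDegree_map, natDegree_hermiteH]; omega), ghError, Finset.sum_eq_zero, sub_zero]
  · simp only [eval_map_hermiteH, mul_assoc]
  · intro a ha
    rw [eval_map_hermiteH, hermiteC_ofReal, eval_hermiteH_of_mem_ghNodes ha]
    simp

open Polynomial ComplexConjugate in
theorem eval_map_conj_ofReal (q : ℂ[X]) (x : ℝ) :
    (q.map (starRingEnd ℂ)).eval (x : ℂ) = conj (q.eval (x : ℂ)) := by
  have := eval_map_apply (p := q) (starRingEnd ℂ) (x : ℂ)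
  rwa [Complex.conj_ofReal] at this

open Polynomial in
/-- A test polynomial `q` of degree at most `n` bounds the error on the Cauchy kernel: the rule is
exact both on the divided difference of `q ^ 2` and on `|q| ^ 2`. -/
theorem norm_sq_eval_mul_norm_kernelError_le (n : ℕ) {z : ℂ} (hz : z.im ≠ 0) (q : ℂ[X])
    (hq : q.natDegree ≤ n) :
    ‖q.eval z‖ ^ 2 * ‖kernelError n z‖
      ≤ 2 / |z.im| * ∫ x : ℝ, hermiteWeight x * ‖q.eval (x : ℂ)‖ ^ 2 := by
  have hn (x : ℝ) : (q * q.map (starRingEnd ℂ)).eval (x : ℂ) = ((‖q.eval (x : ℂ)‖ ^ 2 : ℝ) : ℂ) := by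
    rw [eval_mul, eval_map_conj_ofReal, Complex.mul_conj, Complex.normSq_eq_norm_sq]
  have hsum : ∑ a ∈ ghNodes n, ghWeight n a * ‖q.eval (a : ℂ)‖ ^ 2
      = ∫ x : ℝ, hermiteWeight x * ‖q.eval (x : ℂ)‖ ^ 2 := by
    have h := ghError_eval n (q * q.map (starRingEnd ℂ)) (natDegree_mul_le.trans (by
      rw [natDegree_map]; omega))
    rw [ghError, sub_eq_zero] at h
    simp only [hn] at h
    apply Complex.ofReal_injective
    rw [← integral_complex_ofReal]
    push_cast at h ⊢
    exact h.symm
  have hi : MeasureTheory.Integrable fun x : ℝ => hermiteWeight x * ‖q.eval (x : ℂ)‖ ^ 2 := by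
    have := (integrable_hermiteWeight_mul_eval (q * q.map (starRingEnd ℂ))).re
    simp only [hn, ← Complex.ofReal_mul] at this
    exact this
  have hm : ‖q.eval z‖ ^ 2 * ‖kernelError n z‖ = ‖ghError n fun x =>
      (q * q).eval (x : ℂ) * (z - x)⁻¹‖ := by
    rw [← eval_mul_kernelError n hz (q * q) (natDegree_mul_le.trans (by omega)), eval_mul,
      norm_mul, norm_mul]
    ring
  have hp (x : ℝ) : ‖(q * q).eval (x : ℂ) * (z - x)⁻¹‖ ≤ |z.im|⁻¹ * ‖q.eval (x : ℂ)‖ ^ 2 := by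
    rw [norm_mul, eval_mul, norm_mul, ← pow_two, mul_comm]
    exact mul_le_mul_of_nonneg_right (norm_inv_sub_ofReal_le hz x) (by positivity)
  rw [hm, ghError]
  have h1 : ‖∫ x : ℝ, (hermiteWeight x : ℂ) * ((q * q).eval (x : ℂ) * (z - x)⁻¹)‖
      ≤ |z.im|⁻¹ * ∫ x : ℝ, hermiteWeight x * ‖q.eval (x : ℂ)‖ ^ 2 := by
    rw [← MeasureTheory.integral_const_mul]
    refine MeasureTheory.norm_integral_le_of_norm_le (hi.const_mul _)
      (Filter.Eventually.of_forall fun x => ?_)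
    rw [norm_mul, Complex.norm_real, Real.norm_of_nonneg (hermiteWeight_pos x).le]
    calc _ ≤ hermiteWeight x * (|z.im|⁻¹ * ‖q.eval (x : ℂ)‖ ^ 2) :=
          mul_le_mul_of_nonneg_left (hp x) (hermiteWeight_pos x).le
      _ = _ := by ring
  have h2 : ‖∑ a ∈ ghNodes n, (ghWeight n a : ℂ) * ((q * q).eval (a : ℂ) * (z - a)⁻¹)‖
      ≤ |z.im|⁻¹ * ∫ x : ℝ, hermiteWeight x * ‖q.eval (x : ℂ)‖ ^ 2 := by
    rw [← hsum, Finset.mul_sum]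
    refine (norm_sum_le _ _).trans (Finset.sum_le_sum fun a ha => ?_)
    rw [norm_mul, Complex.norm_real, Real.norm_of_nonneg (ghWeight_nonneg ha)]
    calc _ ≤ ghWeight n a * (|z.im|⁻¹ * ‖q.eval (a : ℂ)‖ ^ 2) :=
          mul_le_mul_of_nonneg_left (hp a) (ghWeight_nonneg ha)
      _ = _ := by ring
  calc _ ≤ _ := (norm_sub_le _ _).trans (add_le_add h1 h2)
    _ = _ := by ring

theorem integral_hermiteWeight_mul_hermiteC_mul_hermiteC (j k : ℕ) :
    ∫ x : ℝ, (hermiteWeight x : ℂ) * hermiteC j x * hermiteC k x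
      = if j = k then ((2 ^ k * k.factorial * √Real.pi : ℝ) : ℂ) else 0 := by
  have hlt (i l : ℕ) (h : l < i) :
      ∫ x : ℝ, (hermiteWeight x : ℂ) * hermiteC i x * hermiteC l x = 0 := by
    have := integral_hermiteWeight_mul_hermiteC_mul_eval i
      ((hermiteH l).map (algebraMap ℝ ℂ)) (by rwa [Polynomial.natDegree_map, natDegree_hermiteH])
    simpa only [eval_map_hermiteH] using this
  split_ifs with h
  · subst h
    induction j with
    | zero =>
      have := integral_gaussian 1
      simp only [neg_one_mul, div_one] at this
      simp only [hermiteC_zero, mul_one]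
      rw [integral_complex_ofReal]
      simp [hermiteWeight, this]
    | succ j ih =>
      have hi (i l : ℕ) : MeasureTheory.Integrable
          fun x : ℝ => (hermiteWeight x : ℂ) * hermiteC i x * hermiteC l x := by
        have := integrable_hermiteWeight_mul_eval
          ((hermiteH i).map (algebraMap ℝ ℂ) * (hermiteH l).map (algebraMap ℝ ℂ))
        simpa only [Polynomial.eval_mul, eval_map_hermiteH, ← mul_assoc] using this
      have e : ∀ x : ℝ, (hermiteWeight x : ℂ) * hermiteC j x * (2 * ((j : ℂ) + 1) * hermiteC j x)
          = 2 * ((j : ℂ) + 1) * ((hermiteWeight x : ℂ) * hermiteC j x * hermiteC j x) :=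
        fun x => by ring
      rw [integral_hermiteWeight_mul_hermiteC_succ_mul j
        (fun x => (hasDerivAt_hermiteC_succ j (x : ℂ)).comp_ofReal) (hi _ _)
        (by simp_rw [e]; exact (hi j j).const_mul _) (hi _ _)]
      simp_rw [e]
      rw [MeasureTheory.integral_const_mul, ih, Nat.factorial_succ]
      push_cast; ring
  · rcases lt_or_gt_of_ne h with h | h
    · rw [← hlt k j h]
      congr 1; funext x; ring
    · exact hlt j k h

/-- The kernel polynomial on the diagonal, `∑_{j < n} |H_j(z)|² / (2^j j!)`; it is `√π` times the
sum of the squared absolute values of the orthonormal Hermite polynomials. -/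
noncomputable def hermiteKernel (n : ℕ) (z : ℂ) : ℝ :=
  ∑ j ∈ Finset.range n, ‖hermiteC j z‖ ^ 2 / (2 ^ j * j.factorial)

theorem hermiteKernel_nonneg (n : ℕ) (z : ℂ) : 0 ≤ hermiteKernel n z :=
  Finset.sum_nonneg fun _ _ => by positivity

theorem hermiteKernel_succ (n : ℕ) (z : ℂ) :
    hermiteKernel (n + 1) z = hermiteKernel n z + ‖hermiteC n z‖ ^ 2 / (2 ^ n * n.factorial) :=
  Finset.sum_range_succ _ _

theorem hermiteKernel_mono (z : ℂ) : Monotone fun n => hermiteKernel n z :=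
  monotone_nat_of_le_succ fun n => by
    rw [hermiteKernel_succ]
    have : 0 ≤ ‖hermiteC n z‖ ^ 2 / (2 ^ n * n.factorial) := by positivity
    linarith

theorem one_le_hermiteKernel_succ (n : ℕ) (z : ℂ) : 1 ≤ hermiteKernel (n + 1) z := by
  have := hermiteKernel_mono z (Nat.succ_le_succ (Nat.zero_le n))
  simpa [hermiteKernel] using this

open Polynomial ComplexConjugate in
theorem hermiteKernel_mul_norm_kernelError_le (n : ℕ) {z : ℂ} (hz : z.im ≠ 0) :
    hermiteKernel (n + 1) z * ‖kernelError n z‖ ≤ 2 * √Real.pi / |z.im| := by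
  -- the extremal test polynomial, i.e. the kernel polynomial with pole at `z`
  set c : ℕ → ℂ := fun j => conj (hermiteC j z) / (2 ^ j * j.factorial) with hc
  set q : ℂ[X] := ∑ j ∈ Finset.range (n + 1), C (c j) * (hermiteH j).map (algebraMap ℝ ℂ) with hq
  have hqe (w : ℂ) : q.eval w = ∑ j ∈ Finset.range (n + 1), c j * hermiteC j w := by
    simp only [hq, eval_finsetSum, eval_mul, eval_C, eval_map_hermiteH]
  have hqz : q.eval z = (hermiteKernel (n + 1) z : ℂ) := by
    rw [hqe, hermiteKernel]
    push_cast
    refine Finset.sum_congr rfl fun j _ => ?_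
    rw [hc, ← Complex.conj_mul']
    ring
  have hqd : q.natDegree ≤ n := by
    refine natDegree_sum_le_of_forall_le _ _ fun j hj => (natDegree_C_mul_le _ _).trans ?_
    rw [natDegree_map, natDegree_hermiteH]
    have := Finset.mem_range.1 hj
    omega
  have hnorm : ∫ x : ℝ, hermiteWeight x * ‖q.eval (x : ℂ)‖ ^ 2
      = √Real.pi * hermiteKernel (n + 1) z := by
    apply Complex.ofReal_injective
    rw [← integral_complex_ofReal]
    have e (x : ℝ) : ((hermiteWeight x * ‖q.eval (x : ℂ)‖ ^ 2 : ℝ) : ℂ)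
        = ∑ j ∈ Finset.range (n + 1), ∑ k ∈ Finset.range (n + 1),
          c j * conj (c k) * ((hermiteWeight x : ℂ) * hermiteC j x * hermiteC k x) := by
      have : ((‖q.eval (x : ℂ)‖ ^ 2 : ℝ) : ℂ) = q.eval (x : ℂ) * conj (q.eval (x : ℂ)) := by
        rw [Complex.mul_conj, Complex.normSq_eq_norm_sq]
      rw [Complex.ofReal_mul, this, hqe, map_sum, Finset.sum_mul_sum, Finset.mul_sum]
      refine Finset.sum_congr rfl fun j _ => ?_
      rw [Finset.mul_sum]
      refine Finset.sum_congr rfl fun k _ => ?_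
      rw [map_mul, ← hermiteC_conj, Complex.conj_ofReal]
      ring
    have hi (i l : ℕ) : MeasureTheory.Integrable
        fun x : ℝ => c i * conj (c l) * ((hermiteWeight x : ℂ) * hermiteC i x * hermiteC l x) := by
      have := (integrable_hermiteWeight_mul_eval
        ((hermiteH i).map (algebraMap ℝ ℂ) * (hermiteH l).map (algebraMap ℝ ℂ))).const_mul
          (c i * conj (c l))
      simpa only [Polynomial.eval_mul, eval_map_hermiteH, ← mul_assoc] using this
    simp_rw [e]
    rw [MeasureTheory.integral_finsetSum _ fun j _ =>
      MeasureTheory.integrable_finsetSum _ fun k _ => hi j k, hermiteKernel]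
    push_cast
    rw [Finset.mul_sum]
    refine Finset.sum_congr rfl fun j hj => ?_
    rw [MeasureTheory.integral_finsetSum _ fun k _ => hi j k]
    simp only [MeasureTheory.integral_const_mul, integral_hermiteWeight_mul_hermiteC_mul_hermiteC,
      mul_ite, mul_zero]
    rw [Finset.sum_ite_eq, if_pos hj, hc]
    have hj0 : (j.factorial : ℂ) ≠ 0 := by exact_mod_cast j.factorial_ne_zero
    have h2 : ((2 : ℂ) ^ j) ≠ 0 := pow_ne_zero j two_ne_zero
    simp only [map_div₀, map_mul, map_pow, Complex.conj_conj, map_ofNat, map_natCast]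
    rw [← Complex.conj_mul']
    push_cast
    field_simp
  have h := norm_sq_eval_mul_norm_kernelError_le n hz q hqd
  have hpos : 0 < hermiteKernel (n + 1) z := lt_of_lt_of_le one_pos (one_le_hermiteKernel_succ n z)
  rw [hqz, hnorm, Complex.norm_real, Real.norm_of_nonneg hpos.le] at h
  refine le_of_mul_le_mul_left ?_ hpos
  calc _ = hermiteKernel (n + 1) z ^ 2 * ‖kernelError n z‖ := by ring
    _ ≤ _ := h
    _ = _ := by ring

/-! ### Fourier representations -/

theorem integrable_pow_mul_cexp_gaussian (N : ℕ) (z : ℂ) :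
    MeasureTheory.Integrable fun t : ℝ =>
      (t : ℂ) ^ N * Complex.exp (-t ^ 2 / 4 + Complex.I * t * z) := by
  have h (c : ℂ) : MeasureTheory.Integrable fun t : ℝ =>
      ‖Complex.exp (-(1 / 4) * (t : ℂ) ^ 2 + c * t + 0)‖ :=
    (integrable_cexp_quadratic (by norm_num) c 0).norm
  refine (((h (1 + Complex.I * z)).add (h (-1 + Complex.I * z))).const_mul
    (N.factorial : ℝ)).mono' (Continuous.aestronglyMeasurable (by fun_prop))
    (Filter.Eventually.of_forall fun t => ?_)
  have hf : (0 : ℝ) < N.factorial := by exact_mod_cast N.factorial_pos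
  have h1 : |t| ^ N ≤ N.factorial * Real.exp |t| := by
    have := Real.pow_div_factorial_le_exp |t| (abs_nonneg t) N
    rwa [div_le_iff₀' hf] at this
  have h2 : Real.exp |t| ≤ Real.exp t + Real.exp (-t) := by
    rcases abs_cases t with ⟨h, -⟩ | ⟨h, -⟩ <;> rw [h] <;> linarith [Real.exp_pos t, Real.exp_pos (-t)]
  have e (ε : ℝ) : ‖Complex.exp (-(1 / 4) * (t : ℂ) ^ 2 + ((ε : ℂ) + Complex.I * z) * t + 0)‖
      = Real.exp (ε * t) * ‖Complex.exp (-t ^ 2 / 4 + Complex.I * t * z)‖ := by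
    rw [← Complex.norm_exp_ofReal, ← norm_mul, ← Complex.exp_add]
    congr 2; push_cast; ring
  have e1 := e 1
  have e2 := e (-1)
  push_cast at e1 e2
  simp only [Pi.add_apply]
  rw [e1, e2, norm_mul, norm_pow, Complex.norm_real, Real.norm_eq_abs, one_mul, neg_one_mul,
    ← add_mul, ← mul_assoc]
  exact mul_le_mul_of_nonneg_right
    (h1.trans (mul_le_mul_of_nonneg_left h2 hf.le)) (norm_nonneg _)

/-- The half-line integral `∫_0^∞ t^N e^{-t²/4 + itz} dt`. -/
noncomputable def halfLineMoment (N : ℕ) (z : ℂ) : ℂ :=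
  ∫ t : ℝ in Set.Ioi 0, (t : ℂ) ^ N * Complex.exp (-t ^ 2 / 4 + Complex.I * t * z)

theorem ofReal_cpow_half {r : ℝ} (hr : 0 ≤ r) : (r : ℂ) ^ (1 / 2 : ℂ) = (√r : ℝ) := by
  rw [Real.sqrt_eq_rpow, Complex.ofReal_cpow hr]
  norm_num

theorem integral_cexp_quarter (z : ℂ) :
    ∫ t : ℝ, Complex.exp (-t ^ 2 / 4 + Complex.I * t * z)
      = (2 * √Real.pi : ℝ) * Complex.exp (-z ^ 2) := by
  have h := fourierIntegral_gaussian (b := 1 / 4) (by norm_num) z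
  have e : (Real.pi : ℂ) / (1 / 4) = ((2 ^ 2 * Real.pi : ℝ) : ℂ) := by push_cast; ring
  rw [e, ofReal_cpow_half (by positivity), Real.sqrt_mul (by positivity),
    Real.sqrt_sq (by norm_num)] at h
  rw [show -z ^ 2 / (4 * (1 / 4)) = -z ^ 2 by ring] at h
  rw [← h]
  congr 1; funext t
  rw [← Complex.exp_add]; congr 1; ring

/-- The three-term recurrence of the Gaussian moments, by integration by parts. For `N = 0` the
first term on the right vanishes, whatever `N - 1` means. -/
theorem integral_pow_mul_cexp_gaussian_succ (N : ℕ) (z : ℂ) :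
    ∫ t : ℝ, (t : ℂ) ^ (N + 1) * Complex.exp (-t ^ 2 / 4 + Complex.I * t * z)
      = 2 * N * (∫ t : ℝ, (t : ℂ) ^ (N - 1) * Complex.exp (-t ^ 2 / 4 + Complex.I * t * z))
        + 2 * Complex.I * z *
          ∫ t : ℝ, (t : ℂ) ^ N * Complex.exp (-t ^ 2 / 4 + Complex.I * t * z) := by
  have hu (t : ℝ) : HasDerivAt (fun t : ℝ => (t : ℂ) ^ N * Complex.exp (Complex.I * t * z))
      ((N * (t : ℂ) ^ (N - 1) + Complex.I * z * (t : ℂ) ^ N) * Complex.exp (Complex.I * t * z)) t := by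
    have h1 := (hasDerivAt_pow N (t : ℂ)).comp_ofReal
    have h2 : HasDerivAt (fun w : ℂ => Complex.exp (Complex.I * w * z))
        (Complex.exp (Complex.I * t * z) * (Complex.I * 1 * z)) (t : ℂ) :=
      (((hasDerivAt_id (t : ℂ)).const_mul Complex.I).mul_const z).cexp
    refine (h1.mul h2.comp_ofReal).congr_deriv ?_
    ring
  have hv (t : ℝ) : HasDerivAt (fun t : ℝ => -2 * Complex.exp (-(t : ℂ) ^ 2 / 4))
      (t * Complex.exp (-(t : ℂ) ^ 2 / 4)) t := by
    have h2 : HasDerivAt (fun w : ℂ => -2 * Complex.exp (-w ^ 2 / 4))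
        (-2 * (Complex.exp (-(t : ℂ) ^ 2 / 4) * (-(((2 : ℕ) : ℂ) * (t : ℂ) ^ (2 - 1)) / 4))) (t : ℂ) :=
      ((((hasDerivAt_pow 2 (t : ℂ)).fun_neg).div_const 4).cexp).const_mul (-2)
    refine h2.comp_ofReal.congr_deriv ?_
    push_cast; ring
  have hi := integrable_pow_mul_cexp_gaussian
  have e0 (t : ℝ) : Complex.exp (-t ^ 2 / 4 + Complex.I * t * z)
      = Complex.exp (-(t : ℂ) ^ 2 / 4) * Complex.exp (Complex.I * t * z) := Complex.exp_add _ _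
  have e1 : ∀ t : ℝ, (t : ℂ) ^ (N + 1) * Complex.exp (-t ^ 2 / 4 + Complex.I * t * z)
      = ((t : ℂ) ^ N * Complex.exp (Complex.I * t * z)) * (t * Complex.exp (-(t : ℂ) ^ 2 / 4)) :=
    fun t => by rw [e0]; ring
  have e2 : ∀ t : ℝ, ((N * (t : ℂ) ^ (N - 1) + Complex.I * z * (t : ℂ) ^ N)
        * Complex.exp (Complex.I * t * z)) * (-2 * Complex.exp (-(t : ℂ) ^ 2 / 4))
      = (-2 * N) * ((t : ℂ) ^ (N - 1) * Complex.exp (-t ^ 2 / 4 + Complex.I * t * z))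
        + (-2 * Complex.I * z) * ((t : ℂ) ^ N * Complex.exp (-t ^ 2 / 4 + Complex.I * t * z)) :=
    fun t => by rw [e0]; ring
  have e3 : ∀ t : ℝ, ((t : ℂ) ^ N * Complex.exp (Complex.I * t * z))
        * (-2 * Complex.exp (-(t : ℂ) ^ 2 / 4))
      = -2 * ((t : ℂ) ^ N * Complex.exp (-t ^ 2 / 4 + Complex.I * t * z)) :=
    fun t => by rw [e0]; ring
  have h := MeasureTheory.integral_mul_deriv_eq_deriv_mul_of_integrable
    (fun t _ => hu t) (fun t _ => hv t)
    ((hi (N + 1) z).congr (Filter.Eventually.of_forall e1))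
    ((((hi (N - 1) z).const_mul (-2 * (N : ℂ))).add
      ((hi N z).const_mul (-2 * Complex.I * z))).congr
        (Filter.Eventually.of_forall fun t => (e2 t).symm))
    (((hi N z).const_mul (-2)).congr (Filter.Eventually.of_forall fun t => (e3 t).symm))
  simp_rw [e1]
  rw [h]
  simp_rw [e2]
  rw [MeasureTheory.integral_add ((hi (N - 1) z).const_mul _) ((hi N z).const_mul _),
    MeasureTheory.integral_const_mul, MeasureTheory.integral_const_mul]
  ring

/-- The Fourier representation of `e^{-z²} H_N(z)`. -/
theorem cexp_mul_hermiteC_eq_integral (N : ℕ) (z : ℂ) :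
    (2 * √Real.pi : ℝ) * Complex.exp (-z ^ 2) * hermiteC N z = (-Complex.I) ^ N *
      ∫ t : ℝ, (t : ℂ) ^ N * Complex.exp (-t ^ 2 / 4 + Complex.I * t * z) := by
  have hI : (-Complex.I) * (-Complex.I) = -1 := by rw [neg_mul_neg, Complex.I_mul_I]
  induction N using Nat.twoStepInduction with
  | zero => simp [integral_cexp_quarter]
  | one =>
    rw [integral_pow_mul_cexp_gaussian_succ, hermiteC_one]
    simp only [pow_zero, one_mul, integral_cexp_quarter]
    push_cast
    linear_combination (2 * (√Real.pi : ℂ) * Complex.exp (-z ^ 2) * 2 * z) * hI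
  | more N ih1 ih2 =>
    rw [integral_pow_mul_cexp_gaussian_succ, hermiteC_add_two, mul_sub]
    have e1 : (2 * √Real.pi : ℝ) * Complex.exp (-z ^ 2) * (2 * z * hermiteC (N + 1) z)
      = 2 * z * ((2 * √Real.pi : ℝ) * Complex.exp (-z ^ 2) * hermiteC (N + 1) z) := by ring
    have e2 : (2 * √Real.pi : ℝ) * Complex.exp (-z ^ 2) * (2 * ((N : ℂ) + 1) * hermiteC N z)
      = 2 * ((N : ℂ) + 1) * ((2 * √Real.pi : ℝ) * Complex.exp (-z ^ 2) * hermiteC N z) := by ring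
    rw [e1, e2, ih1, ih2, Nat.add_sub_cancel]
    generalize (∫ t : ℝ, (t : ℂ) ^ N * Complex.exp (-t ^ 2 / 4 + Complex.I * t * z)) = J0
    generalize (∫ t : ℝ, (t : ℂ) ^ (N + 1) * Complex.exp (-t ^ 2 / 4 + Complex.I * t * z)) = J1
    push_cast
    have hI2 : Complex.I * Complex.I = -1 := Complex.I_mul_I
    rw [pow_succ (-Complex.I) (N + 1), pow_succ (-Complex.I) N]
    linear_combination ((-Complex.I) ^ N * Complex.I * (-2 * z * J1)
      - 2 * ((N : ℂ) + 1) * J0 * (-Complex.I) ^ N) * hI2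

theorem cexp_mul_hermiteC_eq (N : ℕ) (z : ℂ) :
    (2 * √Real.pi : ℝ) * Complex.exp (-z ^ 2) * hermiteC N z = (-Complex.I) ^ N *
      (halfLineMoment N z + (-1) ^ N * halfLineMoment N (-z)) := by
  rw [cexp_mul_hermiteC_eq_integral,
    ← intervalIntegral.integral_Iic_add_Ioi (b := 0)
      (integrable_pow_mul_cexp_gaussian N z).integrableOn
      (integrable_pow_mul_cexp_gaussian N z).integrableOn]
  have h := integral_comp_neg_Ioi (c := 0)
    (f := fun t : ℝ => (t : ℂ) ^ N * Complex.exp (-t ^ 2 / 4 + Complex.I * t * z))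
  rw [neg_zero] at h
  rw [← h, add_comm, halfLineMoment, halfLineMoment, ← MeasureTheory.integral_const_mul]
  congr 3
  funext t
  push_cast
  rw [neg_pow (t : ℂ) N]
  ring_nf

theorem integral_hermiteWeight_mul_hermiteC_mul_cexp (N : ℕ) (t : ℝ) :
    ∫ x : ℝ, (hermiteWeight x : ℂ) * hermiteC N x * Complex.exp (-(Complex.I * t) * x)
      = (-(Complex.I * t)) ^ N * ((√Real.pi : ℝ) * Complex.exp (-t ^ 2 / 4)) := by
  have hn (x : ℝ) : ‖Complex.exp (-(Complex.I * t) * x)‖ ≤ 1 := by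
    rw [Complex.norm_exp]; simp
  have hd (x : ℝ) : HasDerivAt (fun x : ℝ => Complex.exp (-(Complex.I * t) * x))
      (-(Complex.I * t) * Complex.exp (-(Complex.I * t) * x)) x := by
    have := (((hasDerivAt_id (x : ℂ)).const_mul (-(Complex.I * t))).cexp).comp_ofReal
    refine this.congr_deriv ?_
    simp only [id]; ring
  have hi (k : ℕ) : MeasureTheory.Integrable fun x : ℝ =>
      (hermiteWeight x : ℂ) * hermiteC k x * Complex.exp (-(Complex.I * t) * x) :=
    integrable_hermiteWeight_mul_hermiteC_mul k (by fun_prop) hn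
  have e : ∀ k, ∀ x : ℝ, (hermiteWeight x : ℂ) * hermiteC k x *
      (-(Complex.I * t) * Complex.exp (-(Complex.I * t) * x))
      = -(Complex.I * t) *
        ((hermiteWeight x : ℂ) * hermiteC k x * Complex.exp (-(Complex.I * t) * x)) :=
    fun k x => by ring
  induction N with
  | zero =>
    have h := fourierIntegral_gaussian (b := 1) (by norm_num) (-(t : ℂ))
    rw [div_one, ofReal_cpow_half Real.pi_pos.le] at h
    rw [pow_zero, one_mul, show -(t : ℂ) ^ 2 / 4 = -(-(t : ℂ)) ^ 2 / (4 * 1) by ring, ← h]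
    congr 1; funext x
    simp only [hermiteWeight, hermiteC_zero]
    push_cast
    rw [mul_one, mul_comm]
    congr 2 <;> ring
  | succ k ih =>
    rw [integral_hermiteWeight_mul_hermiteC_succ_mul k hd (hi _) (by
      simp_rw [e]; exact (hi k).const_mul _) (hi _)]
    simp_rw [e]
    rw [MeasureTheory.integral_const_mul, ih]
    ring

theorem inv_eq_integral_cexp {w : ℂ} (hw : 0 < w.im) :
    w⁻¹ = -Complex.I * ∫ t : ℝ in Set.Ioi 0, Complex.exp (Complex.I * w * t) := by
  have hw0 : w ≠ 0 := by rintro rfl; simp at hw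
  rw [integral_exp_mul_complex_Ioi (by simpa using hw)]
  simp
  field_simp

/-- The Hermite functions of the second kind as half-line integrals. -/
theorem integral_hermiteWeight_mul_hermiteC_mul_inv (N : ℕ) {z : ℂ} (hz : 0 < z.im) :
    ∫ x : ℝ, (hermiteWeight x : ℂ) * hermiteC N x * (z - x)⁻¹
      = (-Complex.I) ^ (N + 1) * (√Real.pi : ℝ) * halfLineMoment N z := by
  have e1 (x : ℝ) : (hermiteWeight x : ℂ) * hermiteC N x * (z - x)⁻¹
      = -Complex.I * ∫ t : ℝ in Set.Ioi 0, (hermiteWeight x : ℂ) * hermiteC N x *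
        Complex.exp (Complex.I * (z - x) * t) := by
    rw [inv_eq_integral_cexp (w := z - x) (by simpa using hz), MeasureTheory.integral_const_mul]
    ring
  have hint : MeasureTheory.Integrable (Function.uncurry fun (x t : ℝ) =>
      (hermiteWeight x : ℂ) * hermiteC N x * Complex.exp (Complex.I * (z - x) * t))
      (MeasureTheory.volume.prod (MeasureTheory.volume.restrict (Set.Ioi 0))) := by
    have h1 := integrable_hermiteWeight_mul_hermiteC_mul N (g := fun _ => 1) continuous_const
      (C := 1) (by simp)
    have h2 : MeasureTheory.IntegrableOn (fun t : ℝ => Complex.exp (Complex.I * z * t))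
      (Set.Ioi 0) := integrableOn_exp_mul_complex_Ioi (by simpa using hz) 0
    refine (h1.mul_prod h2).mono (Continuous.aestronglyMeasurable ?_)
      (Filter.Eventually.of_forall fun p => le_of_eq ?_)
    · have := continuous_hermiteWeight
      have := continuous_hermiteC N
      unfold Function.uncurry
      fun_prop
    · simp only [Function.uncurry, norm_mul, mul_one, Complex.norm_exp]
      congr 2
      simp
  simp_rw [e1]
  rw [MeasureTheory.integral_const_mul, MeasureTheory.integral_integral_swap hint, halfLineMoment,
    ← MeasureTheory.integral_const_mul, ← MeasureTheory.integral_const_mul]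
  refine MeasureTheory.integral_congr_ae (Filter.Eventually.of_forall fun t => ?_)
  have e2 : ∀ x : ℝ, (hermiteWeight x : ℂ) * hermiteC N x * Complex.exp (Complex.I * (z - x) * t)
      = Complex.exp (Complex.I * t * z) *
        ((hermiteWeight x : ℂ) * hermiteC N x * Complex.exp (-(Complex.I * t) * x)) := fun x => by
    rw [show Complex.I * (z - x) * t = Complex.I * t * z + -(Complex.I * t) * x by ring,
      Complex.exp_add]
    ring
  simp only [e2]
  rw [MeasureTheory.integral_const_mul, integral_hermiteWeight_mul_hermiteC_mul_cexp,
    Complex.exp_add, neg_mul_eq_neg_mul, mul_pow]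
  ring

/-! ### Laplace's method -/

/-- The maximum of `t^N e^{-t²/4}` over `t ≥ 0`, attained at `t = √(2N)`. -/
noncomputable def momentPeak (N : ℕ) : ℝ := √(2 * N) ^ N * Real.exp (-N / 2)

theorem momentPeak_pos (N : ℕ) : 0 < momentPeak N := by
  rcases Nat.eq_zero_or_pos N with rfl | h
  · simp [momentPeak]
  · have : (0 : ℝ) < N := by exact_mod_cast h
    unfold momentPeak
    positivity

theorem tendsto_sqrt_two_mul_natCast :
    Filter.Tendsto (fun N : ℕ => √(2 * (N : ℝ))) Filter.atTop Filter.atTop :=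
  Real.tendsto_sqrt_atTop.comp (tendsto_natCast_atTop_atTop.const_mul_atTop two_pos)

/-- Second-order expansion of `N log (1 + s/a) - a s / 2` at `a = √(2N)`. -/
theorem tendsto_natCast_mul_log_sub (s : ℝ) :
    Filter.Tendsto (fun N : ℕ => N * Real.log (1 + s / √(2 * N)) - √(2 * N) * s / 2)
      Filter.atTop (nhds (-s ^ 2 / 4)) := by
  have hlim : Filter.Tendsto (fun N : ℕ => |s| ^ 3 / √(2 * (N : ℝ))) Filter.atTop (nhds 0) :=
    tendsto_sqrt_two_mul_natCast.const_div_atTop _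
  rw [tendsto_iff_norm_sub_tendsto_zero]
  refine squeeze_zero' (Filter.Eventually.of_forall fun _ => norm_nonneg _) ?_ hlim
  filter_upwards [tendsto_sqrt_two_mul_natCast.eventually_ge_atTop (2 * |s| + 1)] with N hN
  set a := √(2 * (N : ℝ)) with ha
  have hs := abs_nonneg s
  have ha0 : 0 < a := by linarith
  have ha2 : a ^ 2 = 2 * N := Real.sq_sqrt (by positivity)
  have hu : |s| / a ≤ 1 / 2 := by rw [div_le_iff₀ ha0]; linarith
  have habs : |-(s / a)| = |s| / a := by rw [abs_neg, abs_div, abs_of_pos ha0]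
  have h := Real.abs_log_sub_add_sum_range_le (x := -(s / a)) (by rw [habs]; linarith) 2
  rw [habs] at h
  simp only [Finset.sum_range_succ, Finset.sum_range_zero] at h
  have h2 : (|s| / a) ^ (2 + 1) / (1 - |s| / a) ≤ 2 * (|s| / a) ^ 3 := by
    rw [div_le_iff₀ (by linarith)]
    nlinarith [pow_nonneg (div_nonneg hs ha0.le) 3]
  have e : N * Real.log (1 + s / a) - a * s / 2 - -s ^ 2 / 4
      = a ^ 2 / 2 * (0 + (-(s / a)) ^ (0 + 1) / (((0 : ℕ) : ℝ) + 1)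
        + (-(s / a)) ^ (1 + 1) / (((1 : ℕ) : ℝ) + 1) + Real.log (1 - -(s / a))) := by
    rw [sub_neg_eq_add, ha2]
    have : a * s / 2 = 2 * N * (s / a) / 2 := by rw [← ha2]; field_simp
    rw [this]
    have : s ^ 2 / 4 = 2 * N * (s / a) ^ 2 / 4 := by rw [← ha2]; field_simp
    rw [neg_div, this]
    push_cast
    ring
  rw [e, norm_mul, Real.norm_eq_abs, Real.norm_eq_abs, abs_of_nonneg (by positivity)]
  calc _ ≤ a ^ 2 / 2 * (2 * (|s| / a) ^ 3) :=
        mul_le_mul_of_nonneg_left (h.trans h2) (by positivity)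
    _ = _ := by field_simp

/-- Laplace's method: asymptotics of the half-line moments. -/
theorem tendsto_halfLineMoment_div (z : ℂ) :
    Filter.Tendsto (fun N : ℕ => halfLineMoment N z
        * (Complex.exp (-(Complex.I * √(2 * N) * z)) / momentPeak N))
      Filter.atTop (nhds ((√(2 * Real.pi) : ℝ) * Complex.exp (-z ^ 2 / 2))) := by
  -- the integrand recentred at its peak `t = √(2N)`
  set G : ℕ → ℝ → ℂ := fun N t => (Set.Ioi (0 : ℝ)).indicator
    (fun t : ℝ => (t : ℂ) ^ N * Complex.exp (-t ^ 2 / 4 + Complex.I * t * z)) t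
      * (Complex.exp (-(Complex.I * √(2 * N) * z)) / momentPeak N) with hG
  have hGm (N : ℕ) : Measurable (G N) :=
    ((Continuous.measurable (by fun_prop)).indicator measurableSet_Ioi).mul_const _
  have hval (N : ℕ) (hN : 0 < N) (s : ℝ) (hs : 0 < s + √(2 * N)) : G N (s + √(2 * N))
      = Complex.exp (((N * Real.log (1 + s / √(2 * N)) - √(2 * N) * s / 2 - s ^ 2 / 4 : ℝ) : ℂ)
        + Complex.I * s * z) := by
    set a := √(2 * (N : ℝ)) with ha
    have hN' : (0 : ℝ) < N := by exact_mod_cast hN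
    have ha0 : 0 < a := Real.sqrt_pos.2 (by positivity)
    have ha2 : a ^ 2 = 2 * N := Real.sq_sqrt (by positivity)
    have hpos : 0 < 1 + s / a := by
      rw [show 1 + s / a = (s + a) / a by field_simp; ring]; positivity
    have hpow : (s + a) ^ N = a ^ N * Real.exp (N * Real.log (1 + s / a)) := by
      rw [mul_comm (N : ℝ), ← Real.rpow_def_of_pos hpos, Real.rpow_natCast, ← mul_pow]
      congr 1; field_simp; ring
    have hpk : ((momentPeak N : ℝ) : ℂ) = (a : ℂ) ^ N * Complex.exp (-N / 2) := by
      rw [momentPeak]; push_cast; rfl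
    have hpow' : (((s + a : ℝ)) : ℂ) ^ N
        = (a : ℂ) ^ N * Complex.exp ((N * Real.log (1 + s / a) : ℝ)) := by exact_mod_cast hpow
    have ha2' : (a : ℂ) ^ 2 = 2 * N := by exact_mod_cast ha2
    have haN : (a : ℂ) ^ N ≠ 0 := pow_ne_zero _ (by exact_mod_cast ha0.ne')
    rw [hG]
    simp only
    rw [Set.indicator_of_mem (Set.mem_Ioi.2 hs), hpow', hpk, ← ha]
    have e : Complex.exp (((N * Real.log (1 + s / a) - a * s / 2 - s ^ 2 / 4 : ℝ) : ℂ)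
        + Complex.I * s * z) = Complex.exp ((N * Real.log (1 + s / a) : ℝ))
        * Complex.exp (-((s + a : ℝ) : ℂ) ^ 2 / 4 + Complex.I * ((s + a : ℝ) : ℂ) * z)
        * Complex.exp (-(Complex.I * a * z)) / Complex.exp (-N / 2) := by
      rw [← Complex.exp_add, ← Complex.exp_add, ← Complex.exp_sub]
      congr 1
      push_cast
      linear_combination ha2' / 4
    rw [e]
    field_simp
  have hint (N : ℕ) : halfLineMoment N z
        * (Complex.exp (-(Complex.I * √(2 * N) * z)) / momentPeak N)
      = ∫ s : ℝ, G N (s + √(2 * N)) := by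
    rw [MeasureTheory.integral_add_right_eq_self (G N), hG]
    simp only
    rw [MeasureTheory.integral_mul_const, MeasureTheory.integral_indicator measurableSet_Ioi,
      halfLineMoment]
  have hlim : (√(2 * Real.pi) : ℝ) * Complex.exp (-z ^ 2 / 2)
      = ∫ s : ℝ, Complex.exp (((-s ^ 2 / 2 : ℝ) : ℂ) + Complex.I * s * z) := by
    have h := fourierIntegral_gaussian (b := 1 / 2) (by norm_num) z
    have e : (Real.pi : ℂ) / (1 / 2) = ((2 * Real.pi : ℝ) : ℂ) := by push_cast; ring
    rw [e, ofReal_cpow_half (by positivity), show -z ^ 2 / (4 * (1 / 2)) = -z ^ 2 / 2 by ring] at h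
    rw [← h]
    congr 1; funext s
    rw [← Complex.exp_add]; congr 1; push_cast; ring
  simp_rw [hint]
  rw [hlim]
  refine MeasureTheory.tendsto_integral_filter_of_dominated_convergence
    (fun s : ℝ => ‖Complex.exp (-(1 / 4) * (s : ℂ) ^ 2 + (Complex.I * z) * s + 0)‖)
    (Filter.Eventually.of_forall fun N =>
      ((hGm N).comp (measurable_id.add_const _)).aestronglyMeasurable) ?_
    (integrable_cexp_quadratic (by norm_num) _ 0).norm ?_
  · filter_upwards [Filter.eventually_gt_atTop 0] with N hN
    refine Filter.Eventually.of_forall fun s => ?_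
    by_cases hs : 0 < s + √(2 * N)
    · rw [hval N hN s hs, Complex.norm_exp, Complex.norm_exp]
      refine Real.exp_le_exp.2 ?_
      have hN' : (0 : ℝ) < N := by exact_mod_cast hN
      set a := √(2 * (N : ℝ)) with ha
      have ha0 : 0 < a := Real.sqrt_pos.2 (by positivity)
      have ha2 : a ^ 2 = 2 * N := Real.sq_sqrt (by positivity)
      have hpos : 0 < 1 + s / a := by
        rw [show 1 + s / a = (s + a) / a by field_simp; ring]; positivity
      have hlog : N * Real.log (1 + s / a) ≤ a * s / 2 := by
        have h1 := Real.log_le_sub_one_of_pos hpos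
        calc N * Real.log (1 + s / a) ≤ N * (s / a) :=
              mul_le_mul_of_nonneg_left (by linarith) hN'.le
          _ = (a ^ 2 / 2) * (s / a) := by rw [ha2]; ring
          _ = _ := by field_simp
      have e1 : (-(1 / 4) * (s : ℂ) ^ 2 + (Complex.I * z) * s + 0).re
          = -(s ^ 2 / 4) + (Complex.I * s * z).re := by
        simp [pow_two]; ring
      rw [e1, Complex.add_re, Complex.ofReal_re]
      linarith
    · rw [hG]
      simp only
      rw [Set.indicator_of_notMem (by simpa using hs), zero_mul, norm_zero]
      exact norm_nonneg _
  · refine Filter.Eventually.of_forall fun s => ?_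
    have h1 : Filter.Tendsto (fun N : ℕ => Complex.exp
        (((N * Real.log (1 + s / √(2 * N)) - √(2 * N) * s / 2 - s ^ 2 / 4 : ℝ) : ℂ)
          + Complex.I * s * z)) Filter.atTop
        (nhds (Complex.exp (((-s ^ 2 / 2 : ℝ) : ℂ) + Complex.I * s * z))) := by
      refine (Complex.continuous_exp.tendsto _).comp (Filter.Tendsto.add_const _ ?_)
      refine (Complex.continuous_ofReal.tendsto _).comp ?_
      have := (tendsto_natCast_mul_log_sub s).sub_const (s ^ 2 / 4)
      rwa [show -s ^ 2 / 4 - s ^ 2 / 4 = -s ^ 2 / 2 by ring] at this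
    refine h1.congr' ?_
    filter_upwards [Filter.eventually_gt_atTop 0,
      tendsto_sqrt_two_mul_natCast.eventually_gt_atTop (-s)] with N hN hs
    exact (hval N hN s (by linarith)).symm

/-! ### Pointwise asymptotics of the error on the Cauchy kernel -/

theorem tendsto_norm_halfLineMoment {z : ℂ} :
    Filter.Tendsto (fun N : ℕ => ‖halfLineMoment N z‖ * Real.exp (√(2 * N) * z.im) / momentPeak N)
      Filter.atTop (nhds (√(2 * Real.pi) * ‖Complex.exp (-z ^ 2 / 2)‖)) := by
  have h := (tendsto_halfLineMoment_div z).norm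
  rw [norm_mul, Complex.norm_real, Real.norm_of_nonneg (Real.sqrt_nonneg _)] at h
  refine h.congr fun N => ?_
  rw [norm_mul, norm_div, Complex.norm_real, Real.norm_of_nonneg (momentPeak_pos N).le,
    Complex.norm_exp, mul_div_assoc]
  congr 3
  simp

/-- Asymptotics of the Hermite polynomials in the upper half-plane: of the two half-line moments
making up `H_N`, only that at `-z` matters there. -/
theorem tendsto_norm_hermiteC {z : ℂ} (hz : 0 < z.im) :
    Filter.Tendsto (fun N : ℕ => 2 * √Real.pi * ‖Complex.exp (-z ^ 2)‖ * ‖hermiteC N z‖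
        * Real.exp (-(√(2 * N) * z.im)) / momentPeak N)
      Filter.atTop (nhds (√(2 * Real.pi) * ‖Complex.exp (-z ^ 2 / 2)‖)) := by
  have h1 : Filter.Tendsto (fun N : ℕ =>
      ‖halfLineMoment N (-z)‖ * Real.exp (-(√(2 * N) * z.im)) / momentPeak N)
      Filter.atTop (nhds (√(2 * Real.pi) * ‖Complex.exp (-z ^ 2 / 2)‖)) := by
    have := tendsto_norm_halfLineMoment (z := -z)
    simpa using this
  have h2 : Filter.Tendsto (fun N : ℕ =>
      ‖halfLineMoment N z‖ * Real.exp (-(√(2 * N) * z.im)) / momentPeak N)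
      Filter.atTop (nhds 0) := by
    have hd : Filter.Tendsto (fun N : ℕ => Real.exp (-(2 * z.im * √(2 * N)))) Filter.atTop
        (nhds 0) := Real.tendsto_exp_neg_atTop_nhds_zero.comp
      (tendsto_sqrt_two_mul_natCast.const_mul_atTop (by positivity))
    have := (tendsto_norm_halfLineMoment (z := z)).mul hd
    rw [mul_zero] at this
    refine this.congr fun N => ?_
    rw [show -(√(2 * (N : ℝ)) * z.im) = √(2 * N) * z.im + -(2 * z.im * √(2 * N)) by ring,
      Real.exp_add]
    ring
  have hup := h1.add h2
  have hlo := h1.sub h2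
  rw [add_zero] at hup
  rw [sub_zero] at hlo
  have key (N : ℕ) : 2 * √Real.pi * ‖Complex.exp (-z ^ 2)‖ * ‖hermiteC N z‖
      = ‖halfLineMoment N z + (-1) ^ N * halfLineMoment N (-z)‖ := by
    have := congrArg norm (cexp_mul_hermiteC_eq N z)
    rw [norm_mul, norm_mul, Complex.norm_real, Real.norm_of_nonneg (by positivity), norm_mul,
      norm_pow, norm_neg, Complex.norm_I, one_pow, one_mul] at this
    exact this
  have hn (N : ℕ) : ‖(-1) ^ N * halfLineMoment N (-z)‖ = ‖halfLineMoment N (-z)‖ := by simp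
  refine tendsto_of_tendsto_of_tendsto_of_le_of_le hlo hup (fun N => ?_) (fun N => ?_)
  · have h3 := norm_sub_le_norm_add ((-1) ^ N * halfLineMoment N (-z)) (halfLineMoment N z)
    rw [hn, add_comm] at h3
    simp only
    rw [key, ← sub_div, ← sub_mul]
    have := momentPeak_pos N
    gcongr
  · have h3 := norm_add_le (halfLineMoment N z) ((-1) ^ N * halfLineMoment N (-z))
    rw [hn, add_comm ‖halfLineMoment N z‖] at h3
    simp only
    rw [key, ← add_div, ← add_mul]
    have := momentPeak_pos N
    gcongr

theorem tendsto_sqrt_two_mul_succ_sub :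
    Filter.Tendsto (fun n : ℕ => √(2 * ((n + 1 : ℕ) : ℝ)) - √(2 * (n : ℝ))) Filter.atTop
      (nhds 0) := by
  have h := tendsto_sqrt_two_mul_natCast.const_div_atTop 2
  refine squeeze_zero' (Filter.Eventually.of_forall fun n => ?_) ?_ h
  · rw [sub_nonneg]
    exact Real.sqrt_le_sqrt (by push_cast; linarith)
  · filter_upwards [Filter.eventually_gt_atTop 0] with n hn
    have hn' : (0 : ℝ) < n := by exact_mod_cast hn
    have ha : 0 < √(2 * (n : ℝ)) := Real.sqrt_pos.2 (by positivity)
    have ha2 : √(2 * (n : ℝ)) ^ 2 = 2 * n := Real.sq_sqrt (by positivity)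
    have hb2 : √(2 * ((n + 1 : ℕ) : ℝ)) ^ 2 = 2 * (n + 1) := by
      rw [Real.sq_sqrt (by positivity)]; push_cast; ring
    have hb : 0 ≤ √(2 * ((n + 1 : ℕ) : ℝ)) := Real.sqrt_nonneg _
    have hab : √(2 * (n : ℝ)) ≤ √(2 * ((n + 1 : ℕ) : ℝ)) :=
      Real.sqrt_le_sqrt (by push_cast; linarith)
    rw [le_div_iff₀ ha]
    nlinarith

/-- The sharp pointwise asymptotics of the quadrature error on the Cauchy kernel. -/
theorem tendsto_exp_mul_norm_kernelError {z : ℂ} (hz : 0 < z.im) :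
    Filter.Tendsto (fun n : ℕ => Real.exp (2 * z.im * √(2 * n)) * ‖kernelError n z‖)
      Filter.atTop (nhds (2 * Real.pi * ‖Complex.exp (-z ^ 2)‖)) := by
  set L := √(2 * Real.pi) * ‖Complex.exp (-z ^ 2 / 2)‖ with hL
  have hL0 : L ≠ 0 := mul_ne_zero (by positivity) (norm_ne_zero_iff.2 (Complex.exp_ne_zero _))
  have hE0 : 0 < ‖Complex.exp (-z ^ 2)‖ := norm_pos_iff.2 (Complex.exp_ne_zero _)
  have h1 := ((tendsto_norm_halfLineMoment (z := z)).div (tendsto_norm_hermiteC hz) hL0).comp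
    (Filter.tendsto_add_atTop_nat 1)
  rw [div_self hL0] at h1
  have h2 : Filter.Tendsto (fun n : ℕ => Real.exp
      (-(2 * z.im * (√(2 * ((n + 1 : ℕ) : ℝ)) - √(2 * (n : ℝ)))))) Filter.atTop (nhds 1) := by
    have := (tendsto_sqrt_two_mul_succ_sub.const_mul (2 * z.im)).neg
    rw [mul_zero, neg_zero] at this
    have h3 := (Real.continuous_exp.tendsto 0).comp this
    rwa [Real.exp_zero] at h3
  have h3 := (h1.mul h2).const_mul (2 * Real.pi * ‖Complex.exp (-z ^ 2)‖)
  rw [mul_one, mul_one] at h3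
  refine h3.congr fun n => ?_
  have hH : 0 < ‖hermiteC (n + 1) z‖ := norm_pos_iff.2 (hermiteC_ne_zero_of_im_pos hz _)
  have hk : ‖hermiteC (n + 1) z‖ * ‖kernelError n z‖ = √Real.pi * ‖halfLineMoment (n + 1) z‖ := by
    rw [← norm_mul, hermiteC_mul_kernelError n hz.ne', integral_hermiteWeight_mul_hermiteC_mul_inv
      _ hz, norm_mul, norm_mul, Complex.norm_real, Real.norm_of_nonneg (Real.sqrt_nonneg _)]
    simp
  have hk' : ‖halfLineMoment (n + 1) z‖ = ‖hermiteC (n + 1) z‖ * ‖kernelError n z‖ / √Real.pi := by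
    rw [hk]; field_simp
  have hP := momentPeak_pos (n + 1)
  have hpi : √Real.pi ^ 2 = Real.pi := Real.sq_sqrt Real.pi_pos.le
  simp only [Function.comp_apply, Pi.div_apply]
  rw [hk', Real.exp_neg, Real.exp_neg, mul_sub, Real.exp_sub, show 2 * z.im * √(2 * ((n + 1 : ℕ) : ℝ))
    = √(2 * ((n + 1 : ℕ) : ℝ)) * z.im + √(2 * ((n + 1 : ℕ) : ℝ)) * z.im by ring, Real.exp_add]
  have hsp : 0 < √Real.pi := by positivity
  field_simp
  rw [hpi, mul_comm]

/-! ### Uniform bounds for the kernel polynomial -/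

theorem hermiteKernel_neg_re (n : ℕ) (x ρ : ℝ) :
    hermiteKernel n ((-x : ℝ) + ρ * Complex.I) = hermiteKernel n (x + ρ * Complex.I) := by
  refine Finset.sum_congr rfl fun j _ => ?_
  have e : ((-x : ℝ) : ℂ) + ρ * Complex.I = -(starRingEnd ℂ) (x + ρ * Complex.I) := by
    simp
    ring
  rw [e, hermiteC_neg, hermiteC_conj]
  simp

theorem hasDerivAt_norm_sq_hermiteC_succ (n : ℕ) (x ρ : ℝ) :
    HasDerivAt (fun t : ℝ => ‖hermiteC (n + 1) (t + ρ * Complex.I)‖ ^ 2)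
      (4 * (n + 1) * ((starRingEnd ℂ) (hermiteC (n + 1) (x + ρ * Complex.I))
        * hermiteC n (x + ρ * Complex.I)).re) x := by
  have h1 := ((hasDerivAt_hermiteC_succ n ((x : ℂ) + ρ * Complex.I)).comp (x : ℂ)
    ((hasDerivAt_id (x : ℂ)).add_const (ρ * Complex.I))).comp_ofReal
  have h2 := h1.norm_sq
  refine h2.congr_deriv ?_
  rw [Complex.inner]
  simp
  ring

/-- Consecutive terms of the kernel satisfy `(a_{n+1} + a_n)' = 4 x a_n` along horizontal lines. -/
theorem hasDerivAt_hermiteKernel_term_add (n : ℕ) (x ρ : ℝ) :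
    HasDerivAt (fun t : ℝ =>
      ‖hermiteC (n + 1) (t + ρ * Complex.I)‖ ^ 2 / (2 ^ (n + 1) * (n + 1).factorial)
        + ‖hermiteC n (t + ρ * Complex.I)‖ ^ 2 / (2 ^ n * n.factorial))
      (4 * x * (‖hermiteC n (x + ρ * Complex.I)‖ ^ 2 / (2 ^ n * n.factorial))) x := by
  cases n with
  | zero =>
    have h := ((hasDerivAt_norm_sq_hermiteC_succ 0 x ρ).div_const
      (2 ^ (0 + 1) * (0 + 1).factorial)).add_const
        ((1 : ℝ) ^ 2 / (2 ^ 0 * (Nat.factorial 0)))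
    simp only [hermiteC_zero, norm_one]
    refine h.congr_deriv ?_
    simp [hermiteC_one]
    ring
  | succ m =>
    have h := ((hasDerivAt_norm_sq_hermiteC_succ (m + 1) x ρ).div_const
      (2 ^ (m + 1 + 1) * (m + 1 + 1).factorial)).add
      ((hasDerivAt_norm_sq_hermiteC_succ m x ρ).div_const (2 ^ (m + 1) * (m + 1).factorial))
    refine h.congr_deriv ?_
    have hf : ((m + 1).factorial : ℝ) ≠ 0 := by exact_mod_cast (m + 1).factorial_ne_zero
    rw [Nat.factorial_succ (m + 1), hermiteC_add_two]
    rw [← Complex.normSq_eq_norm_sq, Complex.normSq_apply]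
    simp only [map_sub, map_mul, map_add, Complex.mul_re, Complex.sub_re, Complex.add_re,
      Complex.mul_im, Complex.sub_im, Complex.add_im, Complex.conj_re, Complex.conj_im,
      Complex.ofReal_re, Complex.ofReal_im, Complex.I_re, Complex.I_im, Complex.re_ofNat,
      Complex.im_ofNat, Complex.natCast_re, Complex.natCast_im, Complex.one_re, Complex.one_im]
    push_cast
    have h2 : (m : ℝ) + 1 + 1 ≠ 0 := by positivity
    field_simp
    ring

theorem hasDerivAt_hermiteKernel_add (n : ℕ) (x ρ : ℝ) :
    HasDerivAt (fun t : ℝ => hermiteKernel (n + 1) (t + ρ * Complex.I)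
        + hermiteKernel n (t + ρ * Complex.I))
      (4 * x * hermiteKernel n (x + ρ * Complex.I)) x := by
  induction n with
  | zero =>
    simp only [hermiteKernel, Finset.sum_range_succ, Finset.sum_range_zero, hermiteC_zero]
    simpa using hasDerivAt_const x _
  | succ n ih =>
    have h := ih.add (hasDerivAt_hermiteKernel_term_add n x ρ)
    have e : (fun t : ℝ => hermiteKernel (n + 1 + 1) (t + ρ * Complex.I)
        + hermiteKernel (n + 1) (t + ρ * Complex.I))
      = (fun t : ℝ => hermiteKernel (n + 1) (t + ρ * Complex.I)
        + hermiteKernel n (t + ρ * Complex.I)) + fun t : ℝ =>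
        ‖hermiteC (n + 1) (t + ρ * Complex.I)‖ ^ 2 / (2 ^ (n + 1) * (n + 1).factorial)
        + ‖hermiteC n (t + ρ * Complex.I)‖ ^ 2 / (2 ^ n * n.factorial) := by
      funext t
      simp only [Pi.add_apply]
      rw [hermiteKernel_succ (n + 1), hermiteKernel_succ n]
      ring
    rw [e]
    refine h.congr_deriv ?_
    rw [hermiteKernel_succ n]
    ring

/-- Growth of the kernel along a horizontal line, relative to the imaginary axis. -/
theorem pow_div_factorial_mul_hermiteKernel_le (n k : ℕ) (x ρ : ℝ) :
    x ^ (2 * k) / k.factorial * hermiteKernel n (ρ * Complex.I)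
      ≤ hermiteKernel (n + 1 + k) (x + ρ * Complex.I) := by
  wlog hx : 0 ≤ x generalizing x
  · have := this (-x) (by linarith)
    rwa [hermiteKernel_neg_re, (even_two_mul k).neg_pow] at this
  set κ := hermiteKernel n (ρ * Complex.I) with hκ
  have hκ0 : 0 ≤ κ := hermiteKernel_nonneg _ _
  -- a lower bound for the derivative `4 t κ_m(t)` is integrated from the imaginary axis
  have step (m : ℕ) (g g' : ℝ → ℝ) (hg : ∀ t, HasDerivAt g (g' t) t)
      (hle : ∀ t, 0 ≤ t → g' t ≤ 4 * t * hermiteKernel m (t + ρ * Complex.I)) (x : ℝ) (hx : 0 ≤ x) :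
      g x - g 0 + (hermiteKernel (m + 1) (ρ * Complex.I) + hermiteKernel m (ρ * Complex.I))
        ≤ 2 * hermiteKernel (m + 1) (x + ρ * Complex.I) := by
    have hd (t : ℝ) := (hasDerivAt_hermiteKernel_add m t ρ).sub (hg t)
    have hmono := monotoneOn_of_deriv_nonneg (convex_Ici (0 : ℝ))
      (fun t _ => (hd t).continuousAt.continuousWithinAt)
      (fun t _ => (hd t).differentiableAt.differentiableWithinAt)
      (fun t ht => by
        rw [(hd t).deriv, sub_nonneg]
        rw [interior_Ici] at ht
        exact hle t (le_of_lt ht))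
    have h := hmono (Set.mem_Ici.2 le_rfl) (Set.mem_Ici.2 hx) hx
    simp only [Pi.sub_apply, Complex.ofReal_zero, zero_add] at h
    have := hermiteKernel_mono (x + ρ * Complex.I) (Nat.le_succ m)
    simp only [Nat.succ_eq_add_one] at this
    linarith
  induction k generalizing x with
  | zero =>
    have h := step n (fun _ => 0) (fun _ => 0) (fun t => hasDerivAt_const t 0)
      (fun t ht => by have := hermiteKernel_nonneg n (t + ρ * Complex.I); positivity) x hx
    have := hermiteKernel_mono (ρ * Complex.I) (Nat.le_succ n)
    simp only [Nat.succ_eq_add_one] at this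
    simp
    linarith
  | succ k ih =>
    have hf : (0 : ℝ) < k.factorial := by exact_mod_cast k.factorial_pos
    have h := step (n + 1 + k) (fun t => 2 * κ / (k + 1).factorial * t ^ (2 * k + 2))
      (fun t => 2 * κ / (k + 1).factorial * (((2 * k + 2 : ℕ) : ℝ) * t ^ (2 * k + 2 - 1)))
      (fun t => (hasDerivAt_pow (2 * k + 2) t).const_mul _)
      (fun t ht => by
        have h1 := mul_le_mul_of_nonneg_left (ih t ht) (by positivity : 0 ≤ 4 * t)
        refine le_trans (le_of_eq ?_) h1
        rw [Nat.factorial_succ, show 2 * k + 2 - 1 = 2 * k + 1 by omega]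
        push_cast
        have : (k : ℝ) + 1 ≠ 0 := by positivity
        field_simp
        ring) x hx
    have h1 := hermiteKernel_nonneg (n + 1 + k + 1) (ρ * Complex.I)
    have h2 := hermiteKernel_nonneg (n + 1 + k) (ρ * Complex.I)
    simp only [ne_eq, Nat.add_eq_zero_iff, OfNat.ofNat_ne_zero, and_false, not_false_eq_true,
      zero_pow, mul_zero, sub_zero] at h
    rw [show 2 * (k + 1) = 2 * k + 2 by ring, show n + 1 + (k + 1) = n + 1 + k + 1 by ring]
    have e : x ^ (2 * k + 2) / ((k + 1).factorial : ℝ) * κ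
        = (2 * κ / (k + 1).factorial * x ^ (2 * k + 2)) / 2 := by ring
    rw [e]
    linarith

theorem factorial_le_exp_one_mul_sqrt_mul {n : ℕ} (hn : n ≠ 0) :
    (n.factorial : ℝ) ≤ Real.exp 1 * √n * (n / Real.exp 1) ^ n := by
  obtain ⟨m, rfl⟩ := Nat.exists_eq_succ_of_ne_zero hn
  have h := Stirling.stirlingSeq'_antitone (Nat.zero_le m)
  simp only [Function.comp_apply, Nat.succ_eq_add_one, zero_add] at h
  rw [Stirling.stirlingSeq_one, Stirling.stirlingSeq, div_le_div_iff₀ (by positivity)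
    (by positivity), Real.sqrt_mul (by norm_num)] at h
  have h2 : 0 < √(2 : ℝ) := by positivity
  refine le_of_mul_le_mul_right ?_ h2
  calc _ ≤ _ := h
    _ = _ := by simp only [Nat.succ_eq_add_one]; ring

/-- Size of the kernel on the imaginary axis. By Laplace's method and Stirling's formula its `j`-th
term is at least a multiple of `e^{2ρ√(2j)} / √j`, and there are about `√n` terms with `j` so close
to `n` that the exponential is comparable to `e^{2ρ√(2n)}`. -/
theorem exists_le_hermiteKernel {ρ : ℝ} (hρ : 0 < ρ) :
    ∃ c > 0, ∀ᶠ n : ℕ in Filter.atTop,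
      c * Real.exp (2 * ρ * √(2 * n)) ≤ hermiteKernel n (ρ * Complex.I) := by
  set z : ℂ := ρ * Complex.I with hz
  have him : z.im = ρ := by simp [hz]
  have hlim := tendsto_norm_hermiteC (z := z) (by rwa [him])
  rw [him] at hlim
  set L := √(2 * Real.pi) * ‖Complex.exp (-z ^ 2 / 2)‖ with hL
  set D := 2 * √Real.pi * ‖Complex.exp (-z ^ 2)‖ with hD
  have hL0 : 0 < L := mul_pos (by positivity) (norm_pos_iff.2 (Complex.exp_ne_zero _))
  have hD0 : 0 < D := mul_pos (by positivity) (norm_pos_iff.2 (Complex.exp_ne_zero _))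
  set b := (L / 2 / D) ^ 2 / Real.exp 1 with hb
  have hb0 : 0 < b := by positivity
  have hterm : ∀ᶠ j : ℕ in Filter.atTop, b * Real.exp (2 * ρ * √(2 * j)) / √j
      ≤ ‖hermiteC j z‖ ^ 2 / (2 ^ j * j.factorial) := by
    filter_upwards [hlim.eventually_const_lt (show L / 2 < L by linarith),
      Filter.eventually_gt_atTop 0] with j hj hj0
    have hj1 : (0 : ℝ) < j := by exact_mod_cast hj0
    have hP := momentPeak_pos j
    have h1 : L / 2 / D * momentPeak j * Real.exp (√(2 * j) * ρ) ≤ ‖hermiteC j z‖ := by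
      rw [lt_div_iff₀ hP, Real.exp_neg] at hj
      have hE := Real.exp_pos (√(2 * j) * ρ)
      have h2 : L / 2 * momentPeak j * Real.exp (√(2 * j) * ρ) ≤ D * ‖hermiteC j z‖ := by
        rw [← div_eq_mul_inv, lt_div_iff₀ hE] at hj
        exact hj.le
      calc _ = L / 2 * momentPeak j * Real.exp (√(2 * j) * ρ) / D := by ring
        _ ≤ D * ‖hermiteC j z‖ / D := by gcongr
        _ = _ := by field_simp
    have hP2 : momentPeak j ^ 2 = 2 ^ j * (j / Real.exp 1) ^ j := by
      rw [momentPeak, mul_pow, ← pow_mul, mul_comm j 2, pow_mul, Real.sq_sqrt (by positivity),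
        ← Real.exp_nat_mul, mul_pow, div_pow, ← Real.exp_nat_mul]
      rw [show ((2 : ℕ) : ℝ) * (-(j : ℝ) / 2) = -(j * 1) by push_cast; ring, Real.exp_neg]
      ring
    have hE2 : Real.exp (√(2 * j) * ρ) ^ 2 = Real.exp (2 * ρ * √(2 * j)) := by
      rw [← Real.exp_nat_mul]; congr 1; push_cast; ring
    have hf : (0 : ℝ) < j.factorial := by exact_mod_cast j.factorial_pos
    have hsj : 0 < √(j : ℝ) := Real.sqrt_pos.2 hj1
    rw [div_le_div_iff₀ hsj (by positivity)]
    calc b * Real.exp (2 * ρ * √(2 * j)) * (2 ^ j * j.factorial)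
        ≤ b * Real.exp (2 * ρ * √(2 * j)) *
          (2 ^ j * (Real.exp 1 * √j * (j / Real.exp 1) ^ j)) := by
          gcongr
          exact factorial_le_exp_one_mul_sqrt_mul hj0.ne'
      _ = (L / 2 / D * momentPeak j * Real.exp (√(2 * j) * ρ)) ^ 2 * √j := by
          rw [mul_pow, mul_pow, hP2, hE2, hb]
          field_simp
      _ ≤ ‖hermiteC j z‖ ^ 2 * √j := by gcongr
  obtain ⟨j0, hj0⟩ := Filter.eventually_atTop.1 hterm
  refine ⟨b * Real.exp (-(4 * ρ)) / 2, by positivity, ?_⟩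
  filter_upwards [Filter.eventually_ge_atTop (2 * j0 + 4)] with n hn
  set s := Nat.sqrt n with hs
  have hs1 : s * s ≤ n := Nat.sqrt_le n
  have hs2 : n < (s + 1) * (s + 1) := Nat.lt_succ_sqrt n
  have hs3 : 2 ≤ s := by
    by_contra h
    have : s ≤ 1 := by omega
    nlinarith
  have hs4 : 2 * s ≤ n := by nlinarith
  have hn0 : (0 : ℝ) < n := by exact_mod_cast (by omega : 0 < n)
  have hsn : 0 < √(n : ℝ) := Real.sqrt_pos.2 hn0
  have hsq : √(n : ℝ) ≤ 2 * s := by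
    rw [Real.sqrt_le_iff]
    have : (n : ℝ) ≤ (s + 1) * (s + 1) := by exact_mod_cast hs2.le
    have h2 : (2 : ℝ) ≤ s := by exact_mod_cast hs3
    constructor <;> nlinarith
  have hj : ∀ j ∈ Finset.Ico (n - s) n,
      b * Real.exp (2 * ρ * √(2 * n) - 4 * ρ) / √n
        ≤ ‖hermiteC j z‖ ^ 2 / (2 ^ j * j.factorial) := by
    intro j hj
    rw [Finset.mem_Ico] at hj
    refine le_trans ?_ (hj0 j (by omega))
    have hjn : (j : ℝ) ≤ n := by exact_mod_cast hj.2.le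
    have hjp : (0 : ℝ) < j := by exact_mod_cast (by omega : 0 < j)
    have hnj : (n : ℝ) ≤ j + s := by exact_mod_cast (by omega : n ≤ j + s)
    have hss : (s : ℝ) * s ≤ n := by exact_mod_cast hs1
    have hr2 : √(2 * (j : ℝ)) ^ 2 = 2 * j := Real.sq_sqrt (by positivity)
    have hr := Real.sqrt_nonneg (2 * (j : ℝ))
    have hsr : (s : ℝ) ≤ √(2 * (j : ℝ)) + 1 := by
      by_contra h
      nlinarith
    have hroot : √(2 * (n : ℝ)) ≤ √(2 * (j : ℝ)) + 2 := by
      rw [Real.sqrt_le_iff]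
      constructor <;> nlinarith
    have hsj : 0 < √(j : ℝ) := Real.sqrt_pos.2 hjp
    have he : 2 * ρ * √(2 * n) - 4 * ρ ≤ 2 * ρ * √(2 * j) := by nlinarith
    gcongr
  have hsum : s * (b * Real.exp (2 * ρ * √(2 * n) - 4 * ρ) / √n) ≤ hermiteKernel n z := by
    have h1 := Finset.card_nsmul_le_sum _ _ _ hj
    rw [Nat.card_Ico, show n - (n - s) = s by omega, nsmul_eq_mul] at h1
    refine h1.trans (Finset.sum_le_sum_of_subset_of_nonneg ?_ fun _ _ _ => by positivity)
    intro j hj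
    rw [Finset.mem_Ico] at hj
    exact Finset.mem_range.2 hj.2
  refine le_trans ?_ hsum
  rw [Real.exp_sub, Real.exp_neg, ← mul_div_assoc, le_div_iff₀ hsn]
  calc b * (Real.exp (4 * ρ))⁻¹ / 2 * Real.exp (2 * ρ * √(2 * n)) * √n
      ≤ b * (Real.exp (4 * ρ))⁻¹ / 2 * Real.exp (2 * ρ * √(2 * n)) * (2 * s) := by gcongr
    _ = _ := by field_simp

/-- The quadrature error on the Cauchy kernel, rescaled by `e^{2ρ√(2n)}`, decays faster than any
power along the line `Im z = ρ`, uniformly in `n`. -/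
theorem exists_exp_mul_norm_kernelError_le {ρ : ℝ} (hρ : 0 < ρ) (k : ℕ) :
    ∃ C, ∀ᶠ n : ℕ in Filter.atTop, ∀ x : ℝ,
      Real.exp (2 * ρ * √(2 * n)) * ‖kernelError n (x + ρ * Complex.I)‖
        ≤ C / (1 + |x|) ^ (2 * k) := by
  obtain ⟨c, hc, h⟩ := exists_le_hermiteKernel hρ
  set M : ℝ := 4 ^ k * (1 + k.factorial) * Real.exp (2 * ρ * √(2 * k)) / c with hM
  have hM0 : 0 < M := by positivity
  refine ⟨M * (2 * √Real.pi / ρ), ?_⟩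
  filter_upwards [(Filter.tendsto_sub_atTop_nat k).eventually h,
    Filter.eventually_ge_atTop k] with n hn hkn x
  have hk1 := pow_div_factorial_mul_hermiteKernel_le (n - k) k x ρ
  rw [show n - k + 1 + k = n + 1 by omega] at hk1
  have hk0 : hermiteKernel (n - k) (ρ * Complex.I) ≤ hermiteKernel (n + 1) (x + ρ * Complex.I) := by
    have h1 := pow_div_factorial_mul_hermiteKernel_le n 0 x ρ
    simp only [mul_zero, pow_zero, Nat.factorial_zero, Nat.cast_one, div_one, one_mul,
      add_zero] at h1
    exact (hermiteKernel_mono _ (Nat.sub_le n k)).trans h1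
  set κ := hermiteKernel (n - k) (ρ * Complex.I) with hκ
  set κ' := hermiteKernel (n + 1) (x + ρ * Complex.I) with hκ'
  have hκ0 : 0 ≤ κ := hermiteKernel_nonneg _ _
  have hx : (1 + |x|) ^ (2 * k) ≤ 4 ^ k * (1 + x ^ (2 * k)) := by
    have hx0 : 0 ≤ x ^ (2 * k) := (even_two_mul k).pow_nonneg x
    have hax : |x| ^ (2 * k) = x ^ (2 * k) := (even_two_mul k).pow_abs x
    have h4 : (4 : ℝ) ^ k = 2 ^ (2 * k) := by rw [pow_mul]; norm_num
    rcases le_total |x| 1 with h1 | h1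
    · calc (1 + |x|) ^ (2 * k) ≤ 2 ^ (2 * k) :=
            pow_le_pow_left₀ (by positivity) (by linarith) _
        _ ≤ _ := by rw [h4]; nlinarith [pow_pos (two_pos (α := ℝ)) (2 * k)]
    · calc (1 + |x|) ^ (2 * k) ≤ (2 * |x|) ^ (2 * k) :=
            pow_le_pow_left₀ (by positivity) (by linarith) _
        _ ≤ _ := by rw [h4, mul_pow, hax]; nlinarith [pow_pos (two_pos (α := ℝ)) (2 * k)]
  have hroot : √(2 * (n : ℝ)) ≤ √(2 * ((n - k : ℕ) : ℝ)) + √(2 * (k : ℝ)) := by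
    have e : 2 * (n : ℝ) = 2 * ((n - k : ℕ) : ℝ) + 2 * k := by
      rw [Nat.cast_sub hkn]; ring
    have h1 : √(2 * ((n - k : ℕ) : ℝ)) ^ 2 = 2 * ((n - k : ℕ) : ℝ) := Real.sq_sqrt (by positivity)
    have h2 : √(2 * (k : ℝ)) ^ 2 = 2 * k := Real.sq_sqrt (by positivity)
    rw [e, Real.sqrt_le_iff]
    exact ⟨by positivity, by
      nlinarith [Real.sqrt_nonneg (2 * ((n - k : ℕ) : ℝ)), Real.sqrt_nonneg (2 * (k : ℝ))]⟩
  have hE : c * Real.exp (2 * ρ * √(2 * n)) ≤ κ * Real.exp (2 * ρ * √(2 * k)) := by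
    calc c * Real.exp (2 * ρ * √(2 * n))
        ≤ c * Real.exp (2 * ρ * √(2 * ((n - k : ℕ) : ℝ)) + 2 * ρ * √(2 * k)) := by
          gcongr
          nlinarith
      _ = c * Real.exp (2 * ρ * √(2 * ((n - k : ℕ) : ℝ))) * Real.exp (2 * ρ * √(2 * k)) := by
          rw [Real.exp_add, ← mul_assoc c]
      _ ≤ _ := by gcongr
  have hf : (0 : ℝ) < k.factorial := by exact_mod_cast k.factorial_pos
  have hmain : (1 + |x|) ^ (2 * k) * Real.exp (2 * ρ * √(2 * n)) ≤ M * κ' := by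
    have h1 : x ^ (2 * k) * κ ≤ k.factorial * κ' := by
      calc x ^ (2 * k) * κ = k.factorial * (x ^ (2 * k) / k.factorial * κ) := by field_simp
        _ ≤ _ := by gcongr
    calc (1 + |x|) ^ (2 * k) * Real.exp (2 * ρ * √(2 * n))
        ≤ (4 ^ k * (1 + x ^ (2 * k))) * (κ * Real.exp (2 * ρ * √(2 * k)) / c) := by
          refine mul_le_mul hx ?_ (Real.exp_pos _).le ((by positivity : (0 : ℝ) ≤ _).trans hx)
          rw [le_div_iff₀ hc, mul_comm]
          exact hE
      _ = 4 ^ k * Real.exp (2 * ρ * √(2 * k)) / c * (κ + x ^ (2 * k) * κ) := by ring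
      _ ≤ 4 ^ k * Real.exp (2 * ρ * √(2 * k)) / c * (κ' + k.factorial * κ') := by
          gcongr
      _ = _ := by rw [hM]; ring
  have herr := hermiteKernel_mul_norm_kernelError_le n (z := x + ρ * Complex.I)
    (by simpa using hρ.ne')
  have him : ((x : ℂ) + ρ * Complex.I).im = ρ := by simp
  rw [him, abs_of_pos hρ, ← hκ'] at herr
  rw [le_div_iff₀ (by positivity)]
  calc _ = ((1 + |x|) ^ (2 * k) * Real.exp (2 * ρ * √(2 * n)))
        * ‖kernelError n (x + ρ * Complex.I)‖ := by ring
    _ ≤ M * κ' * ‖kernelError n (x + ρ * Complex.I)‖ := by gcongr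
    _ = M * (κ' * ‖kernelError n (x + ρ * Complex.I)‖) := by ring
    _ ≤ _ := by gcongr

/-! ### Contour integrals over the boundary of the strip -/

theorem add_mul_I_mem_strip {ρ y : ℝ} (hy : |y| ≤ ρ) (t : ℝ) : (t + y * Complex.I : ℂ) ∈ strip ρ := by
  simpa [strip] using abs_le.1 hy

theorem continuous_comp_add_mul_I {ρ y : ℝ} (hy : |y| ≤ ρ) {g : ℂ → ℂ}
    (hg : ContinuousOn g (strip ρ)) : Continuous fun t : ℝ => g (t + y * Complex.I) :=
  hg.comp_continuous (by fun_prop) (add_mul_I_mem_strip hy)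

theorem strip_mem_nhds_ofReal {ρ : ℝ} (hρ : 0 < ρ) (x : ℝ) : strip ρ ∈ nhds (x : ℂ) := by
  have h : Complex.im ⁻¹' Set.Icc (-ρ) ρ ∈ nhds (x : ℂ) :=
    Complex.continuous_im.continuousAt.preimage_mem_nhds
      (Icc_mem_nhds (by simpa using hρ) (by simpa using hρ))
  exact h

theorem add_mul_I_sub_ofReal_ne_zero {y : ℝ} (hy : y ≠ 0) (t x : ℝ) :
    (t + y * Complex.I : ℂ) - x ≠ 0 :=
  sub_ofReal_ne_zero (by simpa using hy) x

theorem norm_inv_add_mul_I_sub_ofReal_le {y : ℝ} (hy : y ≠ 0) (t x : ℝ) :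
    ‖((t + y * Complex.I : ℂ) - x)⁻¹‖ ≤ |y|⁻¹ := by
  simpa using norm_inv_sub_ofReal_le (z := t + y * Complex.I) (by simpa using hy) x

/-- The jump of the Cauchy kernel between the two boundary lines is a multiple of the Poisson
kernel. -/
theorem integrable_and_integral_cauchy_kernel_sub {ρ : ℝ} (hρ : 0 < ρ) (x : ℝ) :
    MeasureTheory.Integrable (fun t : ℝ => ((t + (-ρ : ℝ) * Complex.I : ℂ) - x)⁻¹
      - ((t + ρ * Complex.I : ℂ) - x)⁻¹) ∧
    ∫ t : ℝ, (((t + (-ρ : ℝ) * Complex.I : ℂ) - x)⁻¹ - ((t + ρ * Complex.I : ℂ) - x)⁻¹)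
      = 2 * Real.pi * Complex.I := by
  have e (t : ℝ) : ((t + (-ρ : ℝ) * Complex.I : ℂ) - x)⁻¹ - ((t + ρ * Complex.I : ℂ) - x)⁻¹
      = (2 * Complex.I / ρ) * (((1 + ((t - x) / ρ) ^ 2)⁻¹ : ℝ) : ℂ) := by
    have h1 := add_mul_I_sub_ofReal_ne_zero (neg_ne_zero.2 hρ.ne') t x
    have h2 := add_mul_I_sub_ofReal_ne_zero hρ.ne' t x
    have hρ' : (ρ : ℂ) ≠ 0 := by exact_mod_cast hρ.ne'
    have h3 : (1 + ((t - x) / ρ) ^ 2 : ℂ) * ρ ^ 2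
        = ((t + (-ρ : ℝ) * Complex.I : ℂ) - x) * ((t + ρ * Complex.I : ℂ) - x) := by
      field_simp
      push_cast
      linear_combination (ρ : ℂ) ^ 2 * Complex.I_sq
    have h4 : (1 + ((t - x) / ρ) ^ 2 : ℂ) ≠ 0 := by
      intro h; rw [h, zero_mul] at h3
      exact mul_ne_zero h1 h2 h3.symm
    push_cast at h1 h3 ⊢
    rw [inv_sub_inv h1 h2, ← h3]
    field_simp
    ring
  have hi : MeasureTheory.Integrable fun t : ℝ => (1 + ((t - x) / ρ) ^ 2)⁻¹ :=
    ((integrable_inv_one_add_sq).comp_div hρ.ne').comp_sub_right x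
  constructor
  · simp_rw [e]
    exact hi.ofReal.const_mul _
  · simp_rw [e]
    rw [MeasureTheory.integral_const_mul, integral_complex_ofReal,
      MeasureTheory.integral_sub_right_eq_self (fun t : ℝ => (1 + (t / ρ) ^ 2)⁻¹) x,
      MeasureTheory.Measure.integral_comp_div (fun t : ℝ => (1 + t ^ 2)⁻¹) ρ,
      integral_univ_inv_one_add_sq, abs_of_pos hρ, smul_eq_mul]
    have hρ' : (ρ : ℂ) ≠ 0 := by exact_mod_cast hρ.ne'
    push_cast
    field_simp

/-- Cauchy's integral formula for a strip. -/
theorem cauchy_integral_strip {ρ : ℝ} (hρ : 0 < ρ) {g : ℂ → ℂ} (hg : DifferentiableOn ℂ g (strip ρ))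
    {C : ℝ} (hC : ∀ z ∈ strip ρ, ‖g z‖ ≤ C)
    (hi : ∀ y : ℝ, |y| ≤ ρ → MeasureTheory.Integrable fun t : ℝ => g (t + y * Complex.I)) (x : ℝ) :
    2 * Real.pi * Complex.I * g x
      = (∫ t : ℝ, g (t + (-ρ : ℝ) * Complex.I) * ((t + (-ρ : ℝ) * Complex.I : ℂ) - x)⁻¹)
        - ∫ t : ℝ, g (t + ρ * Complex.I) * ((t + ρ * Complex.I : ℂ) - x)⁻¹ := by
  have hx : (x : ℂ) ∈ strip ρ := mem_of_mem_nhds (strip_mem_nhds_ofReal hρ x)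
  have hC0 : 0 ≤ C := (norm_nonneg _).trans (hC x hx)
  set φ := dslope g x with hφ
  have hφd : DifferentiableOn ℂ φ (strip ρ) :=
    (Complex.differentiableOn_dslope (strip_mem_nhds_ofReal hρ x)).2 hg
  have hφe (z : ℂ) (hz : z - x ≠ 0) : φ z = (g z - g x) * (z - x)⁻¹ := by
    rw [hφ, dslope_of_ne _ (sub_ne_zero.1 hz), slope_def_field, div_eq_mul_inv]
  have hh (y : ℝ) (hy : y ≠ 0) (hyρ : |y| ≤ ρ) : MeasureTheory.Integrable fun t : ℝ =>
      g (t + y * Complex.I) * ((t + y * Complex.I : ℂ) - x)⁻¹ := by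
    refine (hi y hyρ).mul_bdd (c := |y|⁻¹) (Continuous.aestronglyMeasurable ?_)
      (Filter.Eventually.of_forall fun t => norm_inv_add_mul_I_sub_ofReal_le hy t x)
    exact Continuous.inv₀ (by fun_prop) fun t => add_mul_I_sub_ofReal_ne_zero hy t x
  have hρa : |ρ| ≤ ρ := (abs_of_pos hρ).le
  have hρn : |-ρ| ≤ ρ := by rw [abs_neg]; exact hρa
  have hm := hh (-ρ) (neg_ne_zero.2 hρ.ne') hρn
  have hp := hh ρ hρ.ne' hρa
  obtain ⟨hk, hkv⟩ := integrable_and_integral_cauchy_kernel_sub hρ x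
  have hint := (hm.sub hp).sub (hk.const_mul (g x))
  have hlim := MeasureTheory.intervalIntegral_tendsto_integral hint Filter.tendsto_neg_atTop_atBot
    Filter.tendsto_id
  -- the difference of the two horizontal integrals equals that of the two vertical ones
  have hrect (T : ℝ) (hT : 0 < T) :
      ∫ t in (-T)..T, ((g (t + (-ρ : ℝ) * Complex.I) * ((t + (-ρ : ℝ) * Complex.I : ℂ) - x)⁻¹
          - g (t + ρ * Complex.I) * ((t + ρ * Complex.I : ℂ) - x)⁻¹)
          - g x * (((t + (-ρ : ℝ) * Complex.I : ℂ) - x)⁻¹ - ((t + ρ * Complex.I : ℂ) - x)⁻¹))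
        = Complex.I * (∫ y in (-ρ)..ρ, φ ((-T : ℝ) + y * Complex.I))
          - Complex.I * ∫ y in (-ρ)..ρ, φ ((T : ℝ) + y * Complex.I) := by
    have h := Complex.integral_boundary_rect_eq_zero_of_differentiableOn φ
      (((-T : ℝ) : ℂ) + (-ρ : ℝ) * Complex.I) ((T : ℝ) + ρ * Complex.I) (hφd.mono (by
        intro z hz
        have := hz.2
        simp only [Set.mem_preimage, Complex.add_im, Complex.ofReal_im, Complex.mul_im,
          Complex.ofReal_re, Complex.I_im, Complex.I_re, mul_one, mul_zero, zero_add,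
          add_zero] at this
        rwa [Set.uIcc_of_le (by linarith)] at this))
    simp only [Complex.add_im, Complex.add_re, Complex.ofReal_im, Complex.mul_im, Complex.mul_re,
          Complex.ofReal_re, Complex.I_im, Complex.I_re, mul_one, mul_zero, zero_add,
          add_zero, sub_zero, smul_eq_mul] at h
    have hci (y : ℝ) (hyρ : |y| ≤ ρ) :
        IntervalIntegrable (fun t : ℝ => φ (t + y * Complex.I)) MeasureTheory.volume (-T) T :=
      (continuous_comp_add_mul_I hyρ hφd.continuousOn).intervalIntegrable _ _
    rw [← intervalIntegral.integral_sub (hci _ hρn) (hci _ hρa)] at h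
    have e : ∀ t : ℝ, (g (t + (-ρ : ℝ) * Complex.I) * ((t + (-ρ : ℝ) * Complex.I : ℂ) - x)⁻¹
          - g (t + ρ * Complex.I) * ((t + ρ * Complex.I : ℂ) - x)⁻¹)
          - g x * (((t + (-ρ : ℝ) * Complex.I : ℂ) - x)⁻¹ - ((t + ρ * Complex.I : ℂ) - x)⁻¹)
        = φ (t + (-ρ : ℝ) * Complex.I) - φ (t + ρ * Complex.I) := fun t => by
      rw [hφe _ (add_mul_I_sub_ofReal_ne_zero (neg_ne_zero.2 hρ.ne') t x),
        hφe _ (add_mul_I_sub_ofReal_ne_zero hρ.ne' t x)]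
      ring
    simp_rw [e]
    linear_combination h
  have hvert (ε : ℝ) (hε : |ε| = 1) : Filter.Tendsto
      (fun T : ℝ => Complex.I * ∫ y in (-ρ)..ρ, φ ((ε * T : ℝ) + y * Complex.I))
      Filter.atTop (nhds 0) := by
    have hb : Filter.Tendsto (fun T : ℝ => 2 * C * |ρ - -ρ| / (T - |x|)) Filter.atTop (nhds 0) :=
      (Filter.tendsto_atTop_add_const_right _ (-|x|) Filter.tendsto_id).const_div_atTop _
    refine squeeze_zero_norm' ?_ hb
    filter_upwards [Filter.eventually_gt_atTop (|x|)] with T hT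
    have hT0 : 0 < T := (abs_nonneg x).trans_lt hT
    rw [norm_mul, Complex.norm_I, one_mul, mul_div_right_comm]
    refine intervalIntegral.norm_integral_le_of_norm_le_const fun y hy => ?_
    rw [Set.uIoc_of_le (by linarith)] at hy
    have hz : ((ε * T : ℝ) + y * Complex.I : ℂ) ∈ strip ρ :=
      add_mul_I_mem_strip (abs_le.2 ⟨hy.1.le, hy.2⟩) _
    have hd : T - |x| ≤ ‖((ε * T : ℝ) + y * Complex.I : ℂ) - x‖ := by
      have h1 := Complex.abs_re_le_norm (((ε * T : ℝ) + y * Complex.I : ℂ) - x)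
      have h2 : (((ε * T : ℝ) + y * Complex.I : ℂ) - x).re = ε * T - x := by simp
      rw [h2] at h1
      have h3 := abs_sub_abs_le_abs_sub (ε * T) x
      rw [abs_mul, hε, one_mul, abs_of_pos hT0] at h3
      linarith
    have hd0 : 0 < T - |x| := by linarith
    rw [hφe _ (norm_pos_iff.1 (hd0.trans_le hd)), norm_mul, norm_inv, ← div_eq_mul_inv]
    refine div_le_div₀ (by positivity) ?_ hd0 hd
    refine (norm_sub_le _ _).trans ?_
    linarith [hC _ hz, hC x hx]
  have hv := (hvert (-1) (by simp)).sub (hvert 1 (by simp))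
  rw [sub_zero] at hv
  have h0 := tendsto_nhds_unique (hlim.congr' (by
    filter_upwards [Filter.eventually_gt_atTop 0] with T hT
    have := hrect T hT
    simp only [neg_one_mul, one_mul]
    exact this)) hv
  simp only [Pi.sub_apply] at h0
  have hmp : MeasureTheory.Integrable fun t : ℝ =>
      g (t + (-ρ : ℝ) * Complex.I) * ((t + (-ρ : ℝ) * Complex.I : ℂ) - x)⁻¹
        - g (t + ρ * Complex.I) * ((t + ρ * Complex.I : ℂ) - x)⁻¹ := hm.sub hp
  rw [MeasureTheory.integral_sub hmp (hk.const_mul (g x)),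
    MeasureTheory.integral_const_mul, hkv, MeasureTheory.integral_sub hm hp] at h0
  linear_combination -h0

open Polynomial in
/-- Applying the error functional under the integral sign in a Cauchy integral. -/
theorem ghError_eval_mul_integral (n : ℕ) (D : ℂ[X]) (hD : D.natDegree ≤ 2 * n + 2) {y : ℝ}
    (hy : y ≠ 0) {G : ℝ → ℂ} (hG : MeasureTheory.Integrable G) :
    MeasureTheory.Integrable (fun x : ℝ => (hermiteWeight x : ℂ) * (D.eval (x : ℂ) *
        ∫ t : ℝ, G t * ((t + y * Complex.I : ℂ) - x)⁻¹)) ∧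
    ghError n (fun x => D.eval (x : ℂ) * ∫ t : ℝ, G t * ((t + y * Complex.I : ℂ) - x)⁻¹)
      = ∫ t : ℝ, G t * (D.eval (t + y * Complex.I) * kernelError n (t + y * Complex.I)) := by
  set F : ℝ → ℝ → ℂ := fun x t => (hermiteWeight x : ℂ) * D.eval (x : ℂ) *
    (G t * ((t + y * Complex.I : ℂ) - x)⁻¹) with hF
  have hint : MeasureTheory.Integrable (Function.uncurry F)
      (MeasureTheory.volume.prod MeasureTheory.volume) := by
    have h := ((integrable_hermiteWeight_mul_eval D).mul_prod hG).mul_bdd (c := |y|⁻¹)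
      (g := fun p : ℝ × ℝ => ((p.2 + y * Complex.I : ℂ) - p.1)⁻¹)
      (Continuous.aestronglyMeasurable (Continuous.inv₀ (by fun_prop)
        fun p => add_mul_I_sub_ofReal_ne_zero hy p.2 p.1))
      (Filter.Eventually.of_forall fun p => norm_inv_add_mul_I_sub_ofReal_le hy p.2 p.1)
    refine h.congr (Filter.Eventually.of_forall fun p => ?_)
    simp only [Function.uncurry, hF]
    ring
  have hk (a : ℝ) : MeasureTheory.Integrable fun t : ℝ =>
      G t * ((t + y * Complex.I : ℂ) - a)⁻¹ :=
    hG.mul_bdd (c := |y|⁻¹) (Continuous.aestronglyMeasurable (Continuous.inv₀ (by fun_prop)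
        fun t => add_mul_I_sub_ofReal_ne_zero hy t a))
      (Filter.Eventually.of_forall fun t => norm_inv_add_mul_I_sub_ofReal_le hy t a)
  have e1 : ∀ x : ℝ, (hermiteWeight x : ℂ) * (D.eval (x : ℂ) *
        ∫ t : ℝ, G t * ((t + y * Complex.I : ℂ) - x)⁻¹) = ∫ t : ℝ, F x t := fun x => by
    simp only [hF]
    rw [MeasureTheory.integral_const_mul, mul_assoc]
  refine ⟨?_, ?_⟩
  · simp_rw [e1]
    exact hint.integral_prod_left
  · rw [ghError]
    simp_rw [e1]
    rw [MeasureTheory.integral_integral_swap hint]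
    have e2 : ∑ a ∈ ghNodes n, (ghWeight n a : ℂ) * (D.eval (a : ℂ) *
          ∫ t : ℝ, G t * ((t + y * Complex.I : ℂ) - a)⁻¹)
        = ∫ t : ℝ, ∑ a ∈ ghNodes n, (ghWeight n a : ℂ) * (D.eval (a : ℂ) *
          (G t * ((t + y * Complex.I : ℂ) - a)⁻¹)) := by
      rw [MeasureTheory.integral_finsetSum _ fun a _ => ((hk a).const_mul _).const_mul _]
      simp only [MeasureTheory.integral_const_mul]
    have hr : MeasureTheory.Integrable fun t : ℝ => ∫ x : ℝ, F x t := hint.integral_prod_right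
    rw [e2, ← MeasureTheory.integral_sub hr
      (MeasureTheory.integrable_finsetSum _ fun a _ => ((hk a).const_mul _).const_mul _)]
    congr 1; funext t
    rw [eval_mul_kernelError n (by simpa using hy) D hD, ← ghError_const_mul, ghError]
    simp only [hF]
    congr 1
    · congr 1; funext x; ring
    · refine Finset.sum_congr rfl fun a _ => by ring

theorem kernelError_conj (n : ℕ) (z : ℂ) :
    kernelError n ((starRingEnd ℂ) z) = (starRingEnd ℂ) (kernelError n z) := by
  simp only [kernelError, ghError, map_sub, map_sum, map_mul, map_inv₀, Complex.conj_ofReal]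
  rw [← integral_conj]
  simp only [map_sub, map_mul, map_inv₀, Complex.conj_ofReal]

theorem aestronglyMeasurable_kernelError (n : ℕ) {y : ℝ} (hy : y ≠ 0) :
    MeasureTheory.AEStronglyMeasurable fun t : ℝ => kernelError n (t + y * Complex.I) := by
  have hc : Continuous fun p : ℝ × ℝ =>
      (hermiteWeight p.2 : ℂ) * ((p.1 + y * Complex.I : ℂ) - p.2)⁻¹ := by
    have := continuous_hermiteWeight
    exact Continuous.mul (by fun_prop) (Continuous.inv₀ (by fun_prop)
      fun p => add_mul_I_sub_ofReal_ne_zero hy p.1 p.2)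
  refine MeasureTheory.AEStronglyMeasurable.sub
    hc.stronglyMeasurable.integral_prod_right.aestronglyMeasurable
    (Continuous.aestronglyMeasurable ?_)
  exact continuous_finsetSum _ fun a _ => continuous_const.mul (Continuous.inv₀ (by fun_prop)
    fun t => add_mul_I_sub_ofReal_ne_zero hy t a)

/-! ### Growth of `f` on the strip -/

theorem rpow_le_two_rpow_abs_mul_one_add_rpow {r : ℝ} (hr : 1 ≤ r) (σ : ℝ) :
    r ^ σ ≤ 2 ^ |σ| * (1 + r) ^ σ := by
  have hr0 : 0 < r := by linarith
  rcases le_total 0 σ with h | h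
  · have h1 : (1 : ℝ) ≤ 2 ^ |σ| := Real.one_le_rpow (by norm_num) (abs_nonneg σ)
    have h2 : r ^ σ ≤ (1 + r) ^ σ := Real.rpow_le_rpow hr0.le (by linarith) h
    nlinarith [Real.rpow_nonneg (by linarith : 0 ≤ 1 + r) σ]
  · have h1 : (2 * r) ^ σ ≤ (1 + r) ^ σ :=
      Real.rpow_le_rpow_of_nonpos (by linarith) (by linarith) h
    rw [Real.mul_rpow (by norm_num) hr0.le] at h1
    have h2 : (2 : ℝ) ^ |σ| * 2 ^ σ = 1 := by
      rw [abs_of_nonpos h, ← Real.rpow_add (by norm_num), neg_add_cancel, Real.rpow_zero]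
    calc r ^ σ = 2 ^ |σ| * (2 ^ σ * r ^ σ) := by rw [← mul_assoc, h2, one_mul]
      _ ≤ _ := by gcongr

/-- A growth bound near infinity and continuity give a bound on the whole strip. -/
theorem exists_norm_le_one_add_rpow {ρ σ : ℝ} {f : ℂ → ℂ} (hf : ContinuousOn f (strip ρ))
    (hgrowth : ∃ C R : ℝ, ∀ z ∈ strip ρ, R ≤ ‖z‖ → ‖f z‖ ≤ C * ‖z‖ ^ σ) :
    ∃ C, 0 ≤ C ∧ ∀ z ∈ strip ρ, ‖f z‖ ≤ C * (1 + ‖z‖) ^ σ := by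
  obtain ⟨C, R, hCR⟩ := hgrowth
  have hclosed : IsClosed (strip ρ) := isClosed_Icc.preimage Complex.continuous_im
  have hcomp : IsCompact (strip ρ ∩ Metric.closedBall 0 (max R 1)) :=
    (isCompact_closedBall 0 _).inter_left hclosed
  have hcont : ContinuousOn (fun z => ‖f z‖ / (1 + ‖z‖) ^ σ)
      (strip ρ ∩ Metric.closedBall 0 (max R 1)) := by
    refine (hf.mono Set.inter_subset_left).norm.div ?_ fun z _ => by positivity
    exact (Continuous.rpow_const (by fun_prop) fun z => Or.inl (by positivity)).continuousOn
  obtain ⟨B, hB⟩ := hcomp.bddAbove_image hcont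
  refine ⟨max (|C| * 2 ^ |σ|) B, le_max_of_le_left (by positivity), fun z hz => ?_⟩
  have hpos : 0 < (1 + ‖z‖) ^ σ := by positivity
  rcases le_total ‖z‖ (max R 1) with h | h
  · have h1 : ‖f z‖ / (1 + ‖z‖) ^ σ ≤ B :=
      hB (Set.mem_image_of_mem _ ⟨hz, by simpa using h⟩)
    rw [div_le_iff₀ hpos] at h1
    exact h1.trans (by gcongr; exact le_max_right _ _)
  · calc ‖f z‖ ≤ C * ‖z‖ ^ σ := hCR z hz ((le_max_left _ _).trans h)
      _ ≤ |C| * ‖z‖ ^ σ := by gcongr; exact le_abs_self C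
      _ ≤ |C| * (2 ^ |σ| * (1 + ‖z‖) ^ σ) := by
          gcongr
          exact rpow_le_two_rpow_abs_mul_one_add_rpow ((le_max_right _ _).trans h) σ
      _ = |C| * 2 ^ |σ| * (1 + ‖z‖) ^ σ := by ring
      _ ≤ _ := by gcongr; exact le_max_left _ _

theorem abs_le_norm_add_mul_I (t y : ℝ) : |t| ≤ ‖(t + y * Complex.I : ℂ)‖ := by
  simpa using Complex.abs_re_le_norm (t + y * Complex.I : ℂ)

theorem one_add_norm_add_mul_I_le {ρ y : ℝ} (hy : |y| ≤ ρ) (t : ℝ) :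
    1 + ‖(t + y * Complex.I : ℂ)‖ ≤ (1 + ρ) * (1 + |t|) := by
  have h := norm_add_le (t : ℂ) (y * Complex.I)
  rw [norm_mul, Complex.norm_I, mul_one, Complex.norm_real, Complex.norm_real, Real.norm_eq_abs,
    Real.norm_eq_abs] at h
  have := abs_nonneg y
  nlinarith [abs_nonneg t]

theorem exists_norm_add_mul_I_le_pow {ρ σ C : ℝ} {f : ℂ → ℂ} (hC0 : 0 ≤ C)
    (hC : ∀ z ∈ strip ρ, ‖f z‖ ≤ C * (1 + ‖z‖) ^ σ) :
    ∃ (B : ℝ) (m : ℕ), ∀ y : ℝ, |y| ≤ ρ → ∀ t : ℝ,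
      ‖f (t + y * Complex.I)‖ ≤ B * (1 + |t|) ^ m := by
  obtain ⟨m, hm⟩ := exists_nat_ge σ
  by_cases hρ : 0 ≤ ρ
  swap
  · exact ⟨0, 0, fun y hy => absurd ((abs_nonneg y).trans hy) hρ⟩
  refine ⟨C * (1 + ρ) ^ m, m, fun y hy t => ?_⟩
  calc _ ≤ C * (1 + ‖(t + y * Complex.I : ℂ)‖) ^ σ := hC _ (add_mul_I_mem_strip hy t)
    _ ≤ C * (1 + ‖(t + y * Complex.I : ℂ)‖) ^ m := by
        gcongr
        rw [← Real.rpow_natCast]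
        exact Real.rpow_le_rpow_of_exponent_le (by linarith [norm_nonneg (t + y * Complex.I : ℂ)]) hm
    _ ≤ C * ((1 + ρ) * (1 + |t|)) ^ m := by
        gcongr
        exact one_add_norm_add_mul_I_le hy t
    _ = _ := by rw [mul_pow]; ring

theorem norm_cexp_neg_sq_add_mul_I (t y : ℝ) :
    ‖Complex.exp (-(t + y * Complex.I) ^ 2)‖ = Real.exp (y ^ 2) * hermiteWeight t := by
  rw [Complex.norm_exp, hermiteWeight, ← Real.exp_add]
  congr 1
  simp [pow_two]
  ring

theorem integrable_norm_cexp_mul_line {ρ y : ℝ} (hy : |y| ≤ ρ) {f : ℂ → ℂ}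
    (hf : ContinuousOn f (strip ρ)) {B : ℝ} {m : ℕ}
    (hB : ∀ t : ℝ, ‖f (t + y * Complex.I)‖ ≤ B * (1 + |t|) ^ m) :
    MeasureTheory.Integrable fun t : ℝ =>
      ‖Complex.exp (-(t + y * Complex.I) ^ 2) * f (t + y * Complex.I)‖ := by
  have h := ((integrable_hermiteWeight_mul
    (continuous_comp_add_mul_I hy hf).aestronglyMeasurable hB).norm).const_mul (Real.exp (y ^ 2))
  refine h.congr (Filter.Eventually.of_forall fun t => ?_)
  simp only [norm_mul, norm_cexp_neg_sq_add_mul_I, Complex.norm_real]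
  rw [Real.norm_of_nonneg (hermiteWeight_pos t).le, mul_assoc]

/-! ### The error bound -/

open Polynomial in
/-- The contour integral representation of the quadrature error. Cauchy's formula is applied to
`f / D` with `D(z) = (z - 2iρ)^{2n+2}`, which decays; the factor `D` then disappears, because the
rule is exact in degree `2n + 1`. -/
theorem ghError_eq_contour_integral {ρ σ : ℝ} (hρ : 0 < ρ) {f : ℂ → ℂ}
    (hf : DifferentiableOn ℂ f (strip ρ)) {C : ℝ} (hC0 : 0 ≤ C)
    (hC : ∀ z ∈ strip ρ, ‖f z‖ ≤ C * (1 + ‖z‖) ^ σ) (n : ℕ) (hn : σ < n + 1) :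
    2 * Real.pi * Complex.I * ghError n (fun x => f x)
      = (∫ t : ℝ, f (t + (-ρ : ℝ) * Complex.I) * kernelError n (t + (-ρ : ℝ) * Complex.I))
        - ∫ t : ℝ, f (t + ρ * Complex.I) * kernelError n (t + ρ * Complex.I) := by
  set D : ℂ[X] := (X - Polynomial.C (2 * ρ * Complex.I)) ^ (2 * n + 2) with hD
  have hDd : D.natDegree ≤ 2 * n + 2 := by rw [hD, natDegree_pow, natDegree_X_sub_C, mul_one]
  have hDe (z : ℂ) : D.eval z = (z - 2 * ρ * Complex.I) ^ (2 * n + 2) := by simp [hD]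
  have hlow (z : ℂ) (hz : z ∈ strip ρ) : ρ ≤ ‖z - 2 * ρ * Complex.I‖ := by
    have h1 := Complex.abs_im_le_norm (z - 2 * ρ * Complex.I)
    have h2 : (z - 2 * ρ * Complex.I).im = z.im - 2 * ρ := by simp
    have h3 : z.im ≤ ρ := hz.2
    rw [h2, abs_of_neg (by linarith)] at h1
    linarith
  have hD0 (z : ℂ) (hz : z ∈ strip ρ) : D.eval z ≠ 0 := by
    rw [hDe]
    exact pow_ne_zero _ (norm_pos_iff.1 (hρ.trans_le (hlow z hz)))
  set g : ℂ → ℂ := fun z => f z / D.eval z with hg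
  have hgd : DifferentiableOn ℂ g (strip ρ) := hf.div D.differentiable.differentiableOn hD0
  set c : ℝ := (1 + 2 * ρ) / ρ + 1 with hc
  have hc0 : 0 < c := by positivity
  have hgb (z : ℂ) (hz : z ∈ strip ρ) :
      ‖g z‖ ≤ C * c ^ (2 * n + 2) * (1 + ‖z‖) ^ (-(2 * n + 2 - σ)) := by
    have h1 : 1 + ‖z‖ ≤ c * ‖z - 2 * ρ * Complex.I‖ := by
      have h2 := norm_add_le (z - 2 * ρ * Complex.I) (2 * ρ * Complex.I)
      rw [sub_add_cancel, norm_mul, Complex.norm_I, norm_mul, Complex.norm_real,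
        Real.norm_of_nonneg hρ.le, Complex.norm_ofNat, mul_one] at h2
      have h3 : 1 + 2 * ρ ≤ (1 + 2 * ρ) / ρ * ‖z - 2 * ρ * Complex.I‖ := by
        rw [div_mul_eq_mul_div, le_div_iff₀ hρ]
        gcongr
        exact hlow z hz
      rw [hc, add_mul, one_mul]
      linarith
    have h2 : (1 + ‖z‖) ^ (2 * n + 2) ≤ c ^ (2 * n + 2) * ‖D.eval z‖ := by
      rw [hDe, norm_pow, ← mul_pow]
      gcongr
    have hD1 := norm_pos_iff.2 (hD0 z hz)
    have hz1 : 0 < 1 + ‖z‖ := by positivity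
    rw [hg, norm_div, div_le_iff₀ hD1]
    calc ‖f z‖ ≤ C * (1 + ‖z‖) ^ σ := hC z hz
      _ = C * ((1 + ‖z‖) ^ (-(2 * n + 2 - σ)) * (1 + ‖z‖) ^ (2 * n + 2)) := by
          rw [← Real.rpow_natCast, ← Real.rpow_add hz1]
          congr 2
          push_cast
          ring
      _ ≤ C * ((1 + ‖z‖) ^ (-(2 * n + 2 - σ)) * (c ^ (2 * n + 2) * ‖D.eval z‖)) := by gcongr
      _ = _ := by ring
  have hn0 : (0 : ℝ) ≤ n := Nat.cast_nonneg n
  have hs : 1 < 2 * (n : ℝ) + 2 - σ := by linarith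
  have hgi (y : ℝ) (hy : |y| ≤ ρ) :
      MeasureTheory.Integrable fun t : ℝ => g (t + y * Complex.I) := by
    have h := (integrable_one_add_norm (E := ℝ) (μ := MeasureTheory.volume)
      (r := 2 * n + 2 - σ) (by simpa using hs)).const_mul (C * c ^ (2 * n + 2))
    refine h.mono' (continuous_comp_add_mul_I hy hgd.continuousOn).aestronglyMeasurable
      (Filter.Eventually.of_forall fun t => (hgb _ (add_mul_I_mem_strip hy t)).trans ?_)
    refine mul_le_mul_of_nonneg_left (Real.rpow_le_rpow_of_nonpos (by positivity) ?_ (by linarith))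
      (by positivity)
    exact add_le_add_right (abs_le_norm_add_mul_I t y) 1
  have hcauchy := cauchy_integral_strip hρ hgd (C := C * c ^ (2 * n + 2)) (fun z hz =>
    (hgb z hz).trans (mul_le_of_le_one_right (by positivity)
      (Real.rpow_le_one_of_one_le_of_nonpos (by linarith [norm_nonneg z]) (by linarith)))) hgi
  have hρa : |ρ| ≤ ρ := (abs_of_pos hρ).le
  have hρn : |-ρ| ≤ ρ := by rw [abs_neg]; exact hρa
  obtain ⟨hi1, he1⟩ := ghError_eval_mul_integral n D hDd (neg_ne_zero.2 hρ.ne') (hgi _ hρn)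
  obtain ⟨hi2, he2⟩ := ghError_eval_mul_integral n D hDd hρ.ne' (hgi _ hρa)
  have hfun : (fun x : ℝ => 2 * Real.pi * Complex.I * f x) = fun x : ℝ =>
      D.eval (x : ℂ) * (∫ t : ℝ, g (t + (-ρ : ℝ) * Complex.I)
        * ((t + (-ρ : ℝ) * Complex.I : ℂ) - x)⁻¹)
      + (-1) * (D.eval (x : ℂ) * ∫ t : ℝ, g (t + ρ * Complex.I)
        * ((t + ρ * Complex.I : ℂ) - x)⁻¹) := by
    funext x
    have hx : (x : ℂ) ∈ strip ρ := mem_of_mem_nhds (strip_mem_nhds_ofReal hρ x)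
    have h1 : f x = D.eval (x : ℂ) * g x := by
      rw [hg]; exact (mul_div_cancel₀ _ (hD0 _ hx)).symm
    rw [h1]
    linear_combination D.eval (x : ℂ) * hcauchy x
  have hcancel (y : ℝ) (hy : |y| ≤ ρ) (t : ℝ) : g (t + y * Complex.I)
      * (D.eval (t + y * Complex.I) * kernelError n (t + y * Complex.I))
      = f (t + y * Complex.I) * kernelError n (t + y * Complex.I) := by
    rw [← mul_assoc, hg, div_mul_cancel₀ _ (hD0 _ (add_mul_I_mem_strip hy t))]
  rw [← ghError_const_mul, hfun, ghError_add hi1, ghError_const_mul, he1, he2]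
  · simp_rw [hcancel _ hρn, hcancel _ hρa]
    ring
  · refine (hi2.const_mul (-1)).congr (Filter.Eventually.of_forall fun x => ?_)
    ring

theorem norm_kernelError_neg_im (n : ℕ) (t ρ : ℝ) :
    ‖kernelError n (t + (-ρ : ℝ) * Complex.I)‖ = ‖kernelError n (t + ρ * Complex.I)‖ := by
  have e : (t + (-ρ : ℝ) * Complex.I : ℂ) = (starRingEnd ℂ) (t + ρ * Complex.I) := by simp
  rw [e, kernelError_conj, Complex.norm_conj]

/-- Dominated convergence on one boundary line. -/
theorem tendsto_integral_norm_mul_kernelError {ρ y : ℝ} (hρ : 0 < ρ) (hy : |y| = ρ) {f : ℂ → ℂ}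
    (hf : ContinuousOn f (strip ρ)) {B : ℝ} {m : ℕ}
    (hB : ∀ t : ℝ, ‖f (t + y * Complex.I)‖ ≤ B * (1 + |t|) ^ m) :
    Filter.Tendsto (fun n : ℕ => Real.exp (2 * ρ * √(2 * n)) / (2 * Real.pi) *
        ∫ t : ℝ, ‖f (t + y * Complex.I) * kernelError n (t + y * Complex.I)‖) Filter.atTop
      (nhds (∫ t : ℝ, ‖Complex.exp (-(t + y * Complex.I) ^ 2) * f (t + y * Complex.I)‖)) := by
  have hy0 : y ≠ 0 := by rintro rfl; simp at hy; exact hρ.ne hy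
  have hker (n : ℕ) (t : ℝ) : ‖kernelError n (t + y * Complex.I)‖
      = ‖kernelError n (t + ρ * Complex.I)‖ := by
    rcases abs_choice y with h | h
    · rw [← hy, h]
    · rw [← hy, h, norm_kernelError_neg_im]
  have hexp (t : ℝ) : ‖Complex.exp (-(t + y * Complex.I) ^ 2)‖
      = ‖Complex.exp (-(t + ρ * Complex.I) ^ 2)‖ := by
    rw [norm_cexp_neg_sq_add_mul_I, norm_cexp_neg_sq_add_mul_I, ← hy, sq_abs]
  have hfc := continuous_comp_add_mul_I hy.le hf
  have hB0 : 0 ≤ B := by simpa using (norm_nonneg _).trans (hB 0)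
  obtain ⟨M, hM⟩ := exists_exp_mul_norm_kernelError_le hρ (m + 1)
  simp_rw [← MeasureTheory.integral_const_mul]
  refine MeasureTheory.tendsto_integral_filter_of_dominated_convergence
    (fun t : ℝ => M * B / (2 * Real.pi) * (1 + ‖t‖) ^ (-2 : ℝ))
    (Filter.Eventually.of_forall fun n =>
      ((hfc.aestronglyMeasurable.mul (aestronglyMeasurable_kernelError n hy0)).norm.const_mul _))
    ?_ ((integrable_one_add_norm (by norm_num)).const_mul _) ?_
  · filter_upwards [hM] with n hn
    refine Filter.Eventually.of_forall fun t => ?_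
    have ht : 0 < 1 + |t| := by positivity
    rw [Real.norm_of_nonneg (by positivity), norm_mul, hker]
    calc _ = ‖f (t + y * Complex.I)‖ / (2 * Real.pi) *
          (Real.exp (2 * ρ * √(2 * n)) * ‖kernelError n (t + ρ * Complex.I)‖) := by ring
      _ ≤ (B * (1 + |t|) ^ m) / (2 * Real.pi) * (M / (1 + |t|) ^ (2 * (m + 1))) := by
          gcongr
          · exact hB t
          · exact hn t
      _ = M * B / (2 * Real.pi) * ((1 + |t|) ^ m / (1 + |t|) ^ (2 * (m + 1))) := by ring
      _ ≤ M * B / (2 * Real.pi) * (1 + ‖t‖) ^ (-2 : ℝ) := by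
          have hM0 : 0 ≤ M := by
            have h1 := hn 0
            simp only [abs_zero, add_zero, one_pow, div_one] at h1
            exact (by positivity : (0 : ℝ) ≤ _).trans h1
          gcongr
          rw [Real.norm_eq_abs, Real.rpow_neg ht.le, Real.rpow_two, ← one_div,
            div_le_div_iff₀ (by positivity) (by positivity), ← pow_add, one_mul]
          exact pow_le_pow_right₀ (by linarith [abs_nonneg t]) (by omega)
  · refine Filter.Eventually.of_forall fun t => ?_
    have h := (tendsto_exp_mul_norm_kernelError (z := t + ρ * Complex.I)
      (by simpa using hρ)).const_mul (‖f (t + y * Complex.I)‖ / (2 * Real.pi))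
    have him : ((t : ℂ) + ρ * Complex.I).im = ρ := by simp
    rw [him] at h
    have e : ‖f (t + y * Complex.I)‖ / (2 * Real.pi)
        * (2 * Real.pi * ‖Complex.exp (-(t + ρ * Complex.I) ^ 2)‖)
        = ‖Complex.exp (-(t + y * Complex.I) ^ 2) * f (t + y * Complex.I)‖ := by
      rw [norm_mul, hexp]
      have := Real.pi_pos
      field_simp
    rw [e] at h
    refine h.congr fun n => ?_
    rw [norm_mul, hker]
    ring

theorem mainTheorem7 (ρ : ℝ) (hρ : 0 < ρ) (σ : ℝ) (f : ℂ → ℂ)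
    (hf : AnalyticOnNhd ℂ f (strip ρ))
    (hgrowth : ∃ C R : ℝ, ∀ z ∈ strip ρ, R ≤ ‖z‖ → ‖f z‖ ≤ C * ‖z‖ ^ σ) :
    MeasureTheory.Integrable (fun x : ℝ => (hermiteWeight x : ℂ) * f x) ∧
    MeasureTheory.Integrable
      (fun x : ℝ => ‖Complex.exp (-(x + ρ * Complex.I) ^ 2) * f (x + ρ * Complex.I)‖) ∧
    MeasureTheory.Integrable
      (fun x : ℝ => ‖Complex.exp (-(x - ρ * Complex.I) ^ 2) * f (x - ρ * Complex.I)‖) ∧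
    ∃ K : ℕ → ℝ,
      (∀ n : ℕ, max ⌊σ⌋ 0 ≤ (n : ℤ) →
        ‖weightedIntegral f - ghQuadrature n f‖ ≤ K n * Real.exp (-2 * ρ * Real.sqrt (2 * n))) ∧
      Filter.Tendsto K Filter.atTop
        (nhds (stripBoundaryIntegral ρ (fun z => ‖Complex.exp (-z ^ 2) * f z‖))) := by
  have hfd : DifferentiableOn ℂ f (strip ρ) := hf.differentiableOn
  obtain ⟨C, hC0, hC⟩ := exists_norm_le_one_add_rpow hfd.continuousOn hgrowth
  obtain ⟨B, m, hB⟩ := exists_norm_add_mul_I_le_pow hC0 hC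
  have hρa : |ρ| = ρ := abs_of_pos hρ
  have hρn : |-ρ| = ρ := by rw [abs_neg, hρa]
  have hsub (x : ℝ) : (x - ρ * Complex.I : ℂ) = x + (-ρ : ℝ) * Complex.I := by push_cast; ring
  refine ⟨?_, integrable_norm_cexp_mul_line hρa.le hfd.continuousOn (hB ρ hρa.le), ?_, ?_⟩
  · have h0 : |(0 : ℝ)| ≤ ρ := by simpa using hρ.le
    have h := integrable_hermiteWeight_mul
      (continuous_comp_add_mul_I h0 hfd.continuousOn).aestronglyMeasurable (hB 0 h0)
    simpa using h
  · simp_rw [hsub]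
    exact integrable_norm_cexp_mul_line hρn.le hfd.continuousOn (hB (-ρ) hρn.le)
  · refine ⟨fun n => Real.exp (2 * ρ * √(2 * n)) / (2 * Real.pi) *
        (∫ t : ℝ, ‖f (t + ρ * Complex.I) * kernelError n (t + ρ * Complex.I)‖)
      + Real.exp (2 * ρ * √(2 * n)) / (2 * Real.pi) *
        ∫ t : ℝ, ‖f (t + (-ρ : ℝ) * Complex.I) * kernelError n (t + (-ρ : ℝ) * Complex.I)‖,
      fun n hn => ?_, ?_⟩
    · have hσ : σ < n + 1 := by
        have h1 : ⌊σ⌋ ≤ (n : ℤ) := (le_max_left _ _).trans hn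
        have h2 : (⌊σ⌋ : ℝ) ≤ n := by exact_mod_cast h1
        linarith [Int.lt_floor_add_one σ]
      have h := congrArg norm (ghError_eq_contour_integral hρ hfd hC0 hC n hσ)
      rw [norm_mul, norm_mul, norm_mul, Complex.norm_I, mul_one, Complex.norm_ofNat,
        Complex.norm_real, Real.norm_of_nonneg Real.pi_pos.le] at h
      have h2 : 2 * Real.pi * ‖ghError n fun x => f x‖
          ≤ (∫ t : ℝ, ‖f (t + (-ρ : ℝ) * Complex.I) * kernelError n (t + (-ρ : ℝ) * Complex.I)‖)
            + ∫ t : ℝ, ‖f (t + ρ * Complex.I) * kernelError n (t + ρ * Complex.I)‖ := by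
        rw [h]
        exact (norm_sub_le _ _).trans (add_le_add (MeasureTheory.norm_integral_le_integral_norm _)
          (MeasureTheory.norm_integral_le_integral_norm _))
      have he : -2 * ρ * √(2 * n) = -(2 * ρ * √(2 * n)) := by ring
      change ‖ghError n fun x => f x‖ ≤ _
      beta_reduce
      rw [he, Real.exp_neg, ← div_eq_mul_inv, le_div_iff₀ (Real.exp_pos _), ← mul_add,
        div_mul_eq_mul_div, le_div_iff₀ (by positivity)]
      calc _ = Real.exp (2 * ρ * √(2 * n)) * (2 * Real.pi * ‖ghError n fun x => f x‖) := by ring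
        _ ≤ _ := mul_le_mul_of_nonneg_left (by linarith) (Real.exp_pos _).le
    · have h := (tendsto_integral_norm_mul_kernelError hρ hρa hfd.continuousOn
          (hB ρ hρa.le)).add
        (tendsto_integral_norm_mul_kernelError hρ hρn hfd.continuousOn (hB (-ρ) hρn.le))
      simp only [stripBoundaryIntegral, hsub]
      exact h
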